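/- Let $M$ be a smooth ($C^\infty$, Hausdorff) manifold of dimension $n$, let $\omega_p$ be a smooth differential $p$-form and $V_q$ a smooth $q$-vector field on $M$. For a smooth coordinate system $\mathbf u=(u^1,\dots,u^n)$ with open domain $U_{\mathbf u}\subseteq M$, say that $\omega_p$ (resp. $V_q$) *has constant coefficients on $\mathbf u$* if all the functions $\omega_p\bigl(\tfrac{\partial}{\partial u^{i_1}},\dots,\tfrac{\partial}{\partial u^{i_p}}\bigr)$, $i_1<\dots<i_p$ (resp. $V_q(du^{i_1},\dots,du^{i_q})$, $i_1<\dots<i_q$) are constant on $U_{\mathbf u}$; and that it *has constant coefficients on a neighbourhood of* $x\in M$ if it has constant coefficients on some coordinate system centred at $x$. Let $\nabla^{\mathbf u}$ be the connection on $U_{\mathbf u}$ given by $\nabla^{\mathbf u}_XY=\sum_i X(Y^i)\tfrac{\partial}{\partial u^i}$ for $Y=\sum_i Y^i\tfrac{\partial}{\partial u^i}$. (0) For every coordinate system $\mathbf u$, $\nabla^{\mathbf u}$ is the unique (smooth) linear connection on $U_{\mathbf u}$ such that $\nabla^{\mathbf u}_{\partial/\partial u^i}\tfrac{\partial}{\partial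 u^j}=0$ for all $i,j$; it is symmetric (torsion-free) and its curvature vanishes. (1) For every coordinate system $\mathbf u$ with connected domain, $\omega_p$ (resp. $V_q$) has constant coefficients on $\mathbf u$ if and only if $\nabla^{\mathbf u}\omega_p=0$ (resp. $\nabla^{\mathbf u}V_q=0$) on $U_{\mathbf u}$. (2) For every $x\in M$, $\omega_p$ (resp. $V_q$) has constant coefficients on a neighbourhood of $x$ if and only if there exist an open neighbourhood $U$ of $x$ and a symmetric (smooth) linear connection $\nabla$ on $U$ such that $R^\nabla=0$ and $\nabla\omega_p=0$ (resp. $\nabla V_q=0$) on $U$. (Taking $U=M$ is allowed, so a connection with these properties on all of $M$ gives constant coefficients near every point.) -/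

import Mathlib

open scoped Manifold ContDiff

noncomputable section

namespace ConstCoeff

variable {n : ℕ} {M : Type*} [TopologicalSpace M] [ChartedSpace (EuclideanSpace ℝ (Fin n)) M]

/-! ### Coordinate systems, coordinate vector fields and coordinate 1-forms -/

variable (n M) in
/-- The smooth coordinate systems `u = (u¹, …, uⁿ)` of `M`: the elements of its maximal
`C^∞` atlas, defined on the open set `u.source`. -/
abbrev coordinateSystems : Set (OpenPartialHomeomorph M (EuclideanSpace ℝ (Fin n))) :=
  IsManifold.maximalAtlas (𝓡 n) ∞ M

/-- The coordinate vector field `∂/∂uⁱ` (meaningful on `u.source`). -/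
def coordField (u : OpenPartialHomeomorph M (EuclideanSpace ℝ (Fin n))) (i : Fin n) (y : M) :
    TangentSpace (𝓡 n) y :=
  mfderiv (𝓡 n) (𝓡 n) u.symm (u y) (EuclideanSpace.single i (1 : ℝ))

/-- The coordinate 1-form `duⁱ` (meaningful on `u.source`). -/
def coordForm (u : OpenPartialHomeomorph M (EuclideanSpace ℝ (Fin n))) (i : Fin n) (y : M) :
    TangentSpace (𝓡 n) y →L[ℝ] ℝ :=
  mvfderiv (𝓡 n) (fun z : M => u z i) y

/-! ### Differential forms, multivector fields, constant coefficients -/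

/-- The value `W(α₁, …, α_q)` of a `q`-vector `W ∈ ⋀^q T` on covectors, given by
`(v₁ ∧ ⋯ ∧ v_q)(α₁, …, α_q) = det (α_j (v_i))`. -/
def multivectorEval {q : ℕ} {y : M} (W : ⋀[ℝ]^q (TangentSpace (𝓡 n) y))
    (α : Fin q → (TangentSpace (𝓡 n) y →L[ℝ] ℝ)) : ℝ :=
  exteriorPower.pairingDual ℝ (TangentSpace (𝓡 n) y) q
    (exteriorPower.ιMulti ℝ q
      (fun k => ((α k : TangentSpace (𝓡 n) y →ₗ[ℝ] ℝ) : Module.Dual ℝ (TangentSpace (𝓡 n) y)))) W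

variable (n M) in
/-- Smooth differential `p`-forms on `M`: smoothness means that the components in every
coordinate system are smooth. -/
structure DiffForm (p : ℕ) where
  /-- The underlying field of alternating forms. -/
  toFun : ∀ y : M, (TangentSpace (𝓡 n) y) [⋀^Fin p]→L[ℝ] ℝ
  smooth : ∀ u ∈ coordinateSystems n M, ∀ I : Fin p → Fin n,
    ContMDiffOn (𝓡 n) 𝓘(ℝ, ℝ) ∞ (fun y => toFun y (fun k => coordField u (I k) y)) u.source

variable (n M) in
/-- Smooth `q`-vector fields on `M`: smoothness means that the components in every
coordinate system are smooth. -/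
structure MultivectorField (q : ℕ) where
  /-- The underlying field of `q`-vectors. -/
  toFun : ∀ y : M, ⋀[ℝ]^q (TangentSpace (𝓡 n) y)
  smooth : ∀ u ∈ coordinateSystems n M, ∀ I : Fin q → Fin n,
    ContMDiffOn (𝓡 n) 𝓘(ℝ, ℝ) ∞
      (fun y => multivectorEval (toFun y) (fun k => coordForm u (I k) y)) u.source

/-- `η` has constant coefficients on the coordinate system `u`: all the functions
`η(∂/∂u^{i₁}, …, ∂/∂u^{i_p})`, `i₁ < ⋯ < i_p`, are constant on the domain of `u`. -/
def DiffForm.ConstCoeffsIn {p : ℕ} (η : DiffForm n M p)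
    (u : OpenPartialHomeomorph M (EuclideanSpace ℝ (Fin n))) : Prop :=
  ∀ I : Fin p ↪o Fin n, ∃ c : ℝ, ∀ y ∈ u.source,
    η.toFun y (fun k => coordField u (I k) y) = c

/-- `V` has constant coefficients on the coordinate system `u`: all the functions
`V(du^{i₁}, …, du^{i_q})`, `i₁ < ⋯ < i_q`, are constant on the domain of `u`. -/
def MultivectorField.ConstCoeffsIn {q : ℕ} (V : MultivectorField n M q)
    (u : OpenPartialHomeomorph M (EuclideanSpace ℝ (Fin n))) : Prop :=
  ∀ I : Fin q ↪o Fin n, ∃ c : ℝ, ∀ y ∈ u.source,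
    multivectorEval (V.toFun y) (fun k => coordForm u (I k) y) = c

/-- `η` has constant coefficients on a neighbourhood of `x`: it has constant coefficients on
some coordinate system centred at `x`. -/
def DiffForm.ConstCoeffsNear {p : ℕ} (η : DiffForm n M p) (x : M) : Prop :=
  ∃ u ∈ coordinateSystems n M, x ∈ u.source ∧ u x = 0 ∧ η.ConstCoeffsIn u

/-- `V` has constant coefficients on a neighbourhood of `x`: it has constant coefficients on
some coordinate system centred at `x`. -/
def MultivectorField.ConstCoeffsNear {q : ℕ} (V : MultivectorField n M q) (x : M) : Prop :=
  ∃ u ∈ coordinateSystems n M, x ∈ u.source ∧ u x = 0 ∧ V.ConstCoeffsIn u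

/-! ### Smooth vector fields and 1-forms on an open set -/

/-- The vector field `X` is smooth on `U`. -/
def SmoothVectorFieldOn (X : ∀ y : M, TangentSpace (𝓡 n) y) (U : Set M)
    [IsManifold (𝓡 n) ∞ M] : Prop :=
  ContMDiffOn (𝓡 n) (𝓡 n).tangent ∞ (fun y => (⟨y, X y⟩ : TangentBundle (𝓡 n) M)) U

/-- The 1-form `α` is smooth on `U`: its components in every coordinate system are. -/
def SmoothOneFormOn (α : ∀ y : M, TangentSpace (𝓡 n) y →L[ℝ] ℝ) (U : Set M) : Prop :=
  ∀ u ∈ coordinateSystems n M, ∀ i : Fin n,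
    ContMDiffOn (𝓡 n) 𝓘(ℝ, ℝ) ∞ (fun y => α y (coordField u i y)) (u.source ∩ U)

/-! ### Linear connections

A linear connection on an open set `U` is given, as in Mathlib, by an operator `cov` on vector
fields; `cov Y y (X y)` is the value of `∇_X Y` at `y`, and only the values at points `y ∈ U`
matter. -/

variable (n M) in
/-- The type of the operators `Y ↦ (y ↦ (v ↦ (∇_v Y)(y)))` on vector fields. -/
abbrev CovOp : Type _ :=
  (∀ y : M, TangentSpace (𝓡 n) y) →
    (∀ y : M, TangentSpace (𝓡 n) y →L[ℝ] TangentSpace (𝓡 n) y)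

/-- `cov` is a smooth linear connection on `U`. -/
structure IsLinearConnectionOn [IsManifold (𝓡 n) ∞ M] (cov : CovOp n M) (U : Set M) : Prop where
  isCovariantDerivativeOn :
    IsCovariantDerivativeOn (I := 𝓡 n) (EuclideanSpace ℝ (Fin n)) cov U
  smooth :
    ContMDiffCovariantDerivativeOn (I := 𝓡 n) (EuclideanSpace ℝ (Fin n)) ∞ cov U

/-- The connection is symmetric (torsion-free) on `U`: `∇_X Y - ∇_Y X - [X, Y] = 0`. -/
def IsSymmetricOn [IsManifold (𝓡 n) ∞ M] (cov : CovOp n M) (U : Set M) : Prop :=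
  ∀ X Y : ∀ y : M, TangentSpace (𝓡 n) y,
    SmoothVectorFieldOn X U → SmoothVectorFieldOn Y U → ∀ y ∈ U,
      cov Y y (X y) - cov X y (Y y) - VectorField.mlieBracket (𝓡 n) X Y y = 0

/-- The curvature vanishes on `U`: `∇_X ∇_Y Z - ∇_Y ∇_X Z - ∇_{[X, Y]} Z = 0`. -/
def IsFlatOn [IsManifold (𝓡 n) ∞ M] (cov : CovOp n M) (U : Set M) : Prop :=
  ∀ X Y Z : ∀ y : M, TangentSpace (𝓡 n) y,
    SmoothVectorFieldOn X U → SmoothVectorFieldOn Y U → SmoothVectorFieldOn Z U → ∀ y ∈ U,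
      cov (fun z => cov Z z (Y z)) y (X y) - cov (fun z => cov Z z (X z)) y (Y y)
        - cov Z y (VectorField.mlieBracket (𝓡 n) X Y y) = 0

/-- The value at `y` of
`(∇_X η)(Y₁, …, Y_p) = X (η(Y₁, …, Y_p)) - ∑_k η(Y₁, …, ∇_X Y_k, …, Y_p)`. -/
def covDerivForm {p : ℕ} (cov : CovOp n M)
    (η : ∀ y : M, (TangentSpace (𝓡 n) y) [⋀^Fin p]→L[ℝ] ℝ)
    (X : ∀ y : M, TangentSpace (𝓡 n) y) (Y : Fin p → ∀ y : M, TangentSpace (𝓡 n) y) (y : M) : ℝ :=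
  mvfderiv (𝓡 n) (fun z => η z (fun k => Y k z)) y (X y)
    - ∑ k, η y (Function.update (fun l => Y l y) k (cov (Y k) y (X y)))

/-- The covector `(∇_X α)(y)` for a 1-form `α`, where
`(∇_X α)(Y) = X (α(Y)) - α(∇_X Y)`. It is written in the frame of the preferred chart at `y`:
`∇_X α = ∑ᵢ (X (α(∂ᵢ)) - α(∇_X ∂ᵢ)) dxⁱ`. -/
def covDerivOneForm (cov : CovOp n M) (α : ∀ y : M, TangentSpace (𝓡 n) y →L[ℝ] ℝ)
    (X : ∀ y : M, TangentSpace (𝓡 n) y) (y : M) : TangentSpace (𝓡 n) y →L[ℝ] ℝ :=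
  let e := chartAt (EuclideanSpace ℝ (Fin n)) y
  ∑ i, (mvfderiv (𝓡 n) (fun z => α z (coordField e i z)) y (X y)
    - α y (cov (coordField e i) y (X y))) • coordForm e i y

/-- The value at `y` of
`(∇_X V)(α₁, …, α_q) = X (V(α₁, …, α_q)) - ∑_k V(α₁, …, ∇_X α_k, …, α_q)`. -/
def covDerivMultivector {q : ℕ} (cov : CovOp n M)
    (V : ∀ y : M, ⋀[ℝ]^q (TangentSpace (𝓡 n) y))
    (X : ∀ y : M, TangentSpace (𝓡 n) y)
    (α : Fin q → ∀ y : M, TangentSpace (𝓡 n) y →L[ℝ] ℝ) (y : M) : ℝ :=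
  mvfderiv (𝓡 n) (fun z => multivectorEval (V z) (fun k => α k z)) y (X y)
    - ∑ k, multivectorEval (V y) (Function.update (fun l => α l y) k (covDerivOneForm cov (α k) X y))

/-- `∇η = 0` on `U`. -/
def DiffForm.ParallelOn [IsManifold (𝓡 n) ∞ M] {p : ℕ} (η : DiffForm n M p) (cov : CovOp n M)
    (U : Set M) : Prop :=
  ∀ (X : ∀ y : M, TangentSpace (𝓡 n) y) (Y : Fin p → ∀ y : M, TangentSpace (𝓡 n) y),
    SmoothVectorFieldOn X U → (∀ k, SmoothVectorFieldOn (Y k) U) →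
      ∀ y ∈ U, covDerivForm cov η.toFun X Y y = 0

/-- `∇V = 0` on `U`. -/
def MultivectorField.ParallelOn [IsManifold (𝓡 n) ∞ M] {q : ℕ} (V : MultivectorField n M q)
    (cov : CovOp n M) (U : Set M) : Prop :=
  ∀ (X : ∀ y : M, TangentSpace (𝓡 n) y) (α : Fin q → ∀ y : M, TangentSpace (𝓡 n) y →L[ℝ] ℝ),
    SmoothVectorFieldOn X U → (∀ k, SmoothOneFormOn (α k) U) →
      ∀ y ∈ U, covDerivMultivector cov V.toFun X α y = 0

/-- The linear connection `∇^u` of a coordinate system `u`, on `u.source`: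
`∇^u_X Y = ∑ᵢ X(Yⁱ) ∂/∂uⁱ` for `Y = ∑ᵢ Yⁱ ∂/∂uⁱ`. It is the connection that parallelizes the
frame `(∂/∂u¹, …, ∂/∂uⁿ)`. -/
def coordConnection (u : OpenPartialHomeomorph M (EuclideanSpace ℝ (Fin n))) : CovOp n M :=
  fun Y y => ∑ i, (mvfderiv (𝓡 n) (fun z => coordForm u i z (Y z)) y).smulRight (coordField u i y)

end ConstCoeff

end

/-! In the coordinates `u` the connection ∇^u is plain differentiation of components
(`coordConnection_apply`). Its torsion therefore vanishes by the coordinate formula for the bracket,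
and its curvature by the symmetry of second derivatives. Uniqueness holds because a connection is
determined by its values on a frame (`IsCovariantDerivativeOn.eq_sum_coordField`). Since the fields
∂/∂uⁱ and the forms duⁱ are ∇^u-parallel, the covariant derivative of a tensor, evaluated on them,
is the derivative of a coefficient; on a connected domain a parallel tensor thus has constant
coefficients. Conversely, constant coefficients make the tensor a fixed multilinear map in
coordinates, and the product rule for that map says exactly that the tensor is parallel.

For the local statement, one direction takes ∇^u itself. The substance of the other is that a
symmetric flat connection is locally some ∇^u (`exists_coordinateSystem_of_flat`). In a chart, let Γ
be the connection form, a 1-form with values in End E. A change of coordinates φ straightens the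
connection when D²φ(v, w) = Dφ(Γ(v, w)). With F = Dφ this reads dF = F · Γ, a total differential
system whose integrability condition is the vanishing of the curvature. It is solved with F = 1 at
the centre by Picard iteration of a radial integral (`exists_hasFDerivAt_leftMulForm`): flatness
makes the defects dF_k − F_k · Γ decay geometrically along with the steps. Symmetry of Γ makes F,
read as an E-valued 1-form, closed, so the Poincaré lemma on a ball yields φ
(`exists_flat_coordinates`). As Dφ = 1 at the centre, the inverse function theorem turns φ into a
coordinate system. Its frame is parallel, so the connection is ∇^u there, and the criterion for ∇^u
applies.

Restriction to smaller open sets needs an argument, since fields smooth only on the smaller set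
become admissible test fields. They are replaced near a point by global fields cut off with bump
functions, which is where Hausdorffness enters. -/

noncomputable section

set_option linter.unusedSectionVars false

section

open MeasureTheory Filter Topology Set Interval


/-! ### Radial primitives of 1-forms -/

section RadialIntegral

variable {E A : Type*} [NormedAddCommGroup E] [NormedSpace ℝ E] [FiniteDimensional ℝ E]
  [NormedAddCommGroup A] [NormedSpace ℝ A] [CompleteSpace A]

/-- The derivative of the radial primitive of a `1`-form `θ`: it is `θ` up to a term involving
the exterior derivative of `θ`. -/
theorem hasFDerivAt_radialIntegral {θ : E → E →L[ℝ] A} (hθ : ContDiff ℝ 1 θ) (x : E) :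
    HasFDerivAt (fun x => ∫ t in (0 : ℝ)..1, θ (t • x) x)
      (θ x + ∫ t in (0 : ℝ)..1, t • ((fderiv ℝ θ (t • x)).flip x - fderiv ℝ θ (t • x) x)) x := by
  have hc : Continuous θ := hθ.continuous
  have hd : Continuous (fderiv ℝ θ) := hθ.continuous_fderiv one_ne_zero
  have hdiff : ∀ z, HasFDerivAt θ (fderiv ℝ θ z) z :=
    fun z => (hθ.differentiable one_ne_zero z).hasFDerivAt
  have hflip : Continuous fun z => (fderiv ℝ θ z).flip :=
    (ContinuousLinearMap.flipₗᵢ ℝ E E A).continuous.comp hd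
  have hF' : Continuous fun q : E × ℝ =>
      θ (q.2 • q.1) + q.2 • (fderiv ℝ θ (q.2 • q.1)).flip q.1 := by
    have h1 : Continuous fun q : E × ℝ => q.2 • q.1 := by fun_prop
    exact (hc.comp h1).add (continuous_snd.smul ((hflip.comp h1).clm_apply continuous_fst))
  -- By compactness one constant dominates the derivative in `x` of the integrand, for all points
  -- within distance 1 and all `t` in [0, 1]; this permits differentiation under the integral sign.
  obtain ⟨C, hC⟩ := ((isCompact_closedBall x 1).prod (isCompact_Icc (a := (0 : ℝ)) (b := 1))
    ).exists_bound_of_continuousOn hF'.continuousOn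
  have hcont : ∀ y : E, Continuous fun t : ℝ => θ (t • y) y := fun y => by fun_prop
  have key := intervalIntegral.hasFDerivAt_integral_of_dominated_of_fderiv_le (𝕜 := ℝ)
    (μ := volume) (a := 0) (b := 1) (F := fun y t => θ (t • y) y)
    (F' := fun y t => θ (t • y) + t • (fderiv ℝ θ (t • y)).flip y) (x₀ := x)
    (bound := fun _ => C) (Metric.closedBall_mem_nhds x one_pos)
    (Eventually.of_forall fun y => (hcont y).aestronglyMeasurable)
    ((hcont x).intervalIntegrable _ _)
    (hF'.comp (Continuous.prodMk_right x)).aestronglyMeasurable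
    (Eventually.of_forall fun t ht y hy => by
      refine hC (y, t) ⟨hy, ?_⟩
      rw [uIoc_of_le zero_le_one] at ht
      exact ⟨ht.1.le, ht.2⟩)
    intervalIntegrable_const
    (Eventually.of_forall fun t _ y _ => by
      have h1 : HasFDerivAt (fun y : E => θ (t • y))
          ((fderiv ℝ θ (t • y)).comp (t • ContinuousLinearMap.id ℝ E)) y :=
        (hdiff (t • y)).comp y ((hasFDerivAt_id y).const_smul t)
      refine (h1.clm_apply (hasFDerivAt_id y)).congr_fderiv ?_
      ext v
      simp)
  refine key.congr_fderiv ?_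
  -- The fundamental theorem of calculus for t ↦ t θ(tx). What remains of the differentiated
  -- integrand after this part is removed is the antisymmetrization of Dθ, i.e. dθ contracted with
  -- `x`.
  have hftc : ∫ t in (0 : ℝ)..1, (θ (t • x) + t • fderiv ℝ θ (t • x) x) = θ x := by
    have : ∀ t ∈ uIcc (0 : ℝ) 1, HasDerivAt (fun t : ℝ => t • θ (t • x))
        (θ (t • x) + t • fderiv ℝ θ (t • x) x) t := fun t _ => by
      have h1 : HasDerivAt (fun t : ℝ => θ (t • x)) (fderiv ℝ θ (t • x) x) t := by
        have := (hdiff (t • x)).comp_hasDerivAt t ((hasDerivAt_id t).smul_const x)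
        simpa using! this
      have := (hasDerivAt_id t).smul h1
      simpa [add_comm] using! this
    rw [intervalIntegral.integral_eq_sub_of_hasDerivAt this]
    · simp
    · exact Continuous.intervalIntegrable (by fun_prop) _ _
  rw [← hftc, ← intervalIntegral.integral_add]
  · congr 1
    ext1 t
    rw [smul_sub]
    abel
  · exact Continuous.intervalIntegrable (by fun_prop) _ _
  · refine Continuous.intervalIntegrable ?_ _ _
    have h1 : Continuous fun t : ℝ => t • x := by fun_prop
    exact continuous_id.smul (((hflip.comp h1).clm_apply continuous_const).sub
      ((hd.comp h1).clm_apply continuous_const))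

/-- The derivative formula involves only `θ` and its first derivative, both continuous. No order of
differentiability is lost, so the Picard iteration stays within C¹. -/
theorem contDiff_one_radialIntegral {θ : E → E →L[ℝ] A} (hθ : ContDiff ℝ 1 θ) :
    ContDiff ℝ 1 fun x => ∫ t in (0 : ℝ)..1, θ (t • x) x := by
  have hd : Continuous (fderiv ℝ θ) := hθ.continuous_fderiv one_ne_zero
  have hflip : Continuous fun z => (fderiv ℝ θ z).flip :=
    (ContinuousLinearMap.flipₗᵢ ℝ E E A).continuous.comp hd
  rw [contDiff_one_iff_fderiv]
  refine ⟨fun x => (hasFDerivAt_radialIntegral hθ x).differentiableAt, ?_⟩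
  have : fderiv ℝ (fun x => ∫ t in (0 : ℝ)..1, θ (t • x) x) = fun x => θ x +
      ∫ t in (0 : ℝ)..1, t • ((fderiv ℝ θ (t • x)).flip x - fderiv ℝ θ (t • x) x) :=
    funext fun x => (hasFDerivAt_radialIntegral hθ x).fderiv
  rw [this]
  refine hθ.continuous.add ?_
  apply intervalIntegral.continuous_parametric_intervalIntegral_of_continuous'
  have h1 : Continuous fun q : E × ℝ => q.2 • q.1 := by fun_prop
  exact continuous_snd.smul (((hflip.comp h1).clm_apply continuous_fst).sub
      ((hd.comp h1).clm_apply continuous_fst))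

end RadialIntegral

/-! ### Integrable total differential systems dF = F · Γ -/

section FlatSystem

variable {E A : Type*} [NormedAddCommGroup E] [NormedSpace ℝ E] [FiniteDimensional ℝ E]
  [NormedRing A] [NormedAlgebra ℝ A] [CompleteSpace A]

/-- The `1`-form `F · Γ`. -/
noncomputable def leftMulForm (Γ : E → E →L[ℝ] A) (F : E → A) (x : E) : E →L[ℝ] A :=
  (ContinuousLinearMap.mul ℝ A (F x)).comp (Γ x)

/-- The Picard iterates of the linear system `dF = F · Γ`, `F 0 = 1`. -/
noncomputable def flatIterate (Γ : E → E →L[ℝ] A) : ℕ → E → A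
  | 0 => fun _ => 1
  | k + 1 => fun x => 1 + ∫ t in (0 : ℝ)..1, leftMulForm Γ (flatIterate Γ k) (t • x) x

theorem leftMulForm_apply (Γ : E → E →L[ℝ] A) (F : E → A) (x v : E) :
    leftMulForm Γ F x v = F x * Γ x v := rfl

theorem norm_leftMulForm_le (Γ : E → E →L[ℝ] A) (F : E → A) (x : E) :
    ‖leftMulForm Γ F x‖ ≤ ‖F x‖ * ‖Γ x‖ :=
  (ContinuousLinearMap.opNorm_comp_le _ _).trans
    (mul_le_mul_of_nonneg_right (ContinuousLinearMap.opNorm_mul_apply_le ℝ A _) (norm_nonneg _))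

theorem ContDiff.leftMulForm {Γ : E → E →L[ℝ] A} {F : E → A} {k : ℕ∞ω} (hΓ : ContDiff ℝ k Γ)
    (hF : ContDiff ℝ k F) : ContDiff ℝ k (leftMulForm Γ F) :=
  ((ContinuousLinearMap.mul ℝ A).contDiff.comp hF).clm_comp hΓ

theorem contDiff_flatIterate {Γ : E → E →L[ℝ] A} (hΓ : ContDiff ℝ 1 Γ) (k : ℕ) :
    ContDiff ℝ 1 (flatIterate Γ k) := by
  induction k with
  | zero => exact contDiff_const
  | succ k ih => exact contDiff_const.add (contDiff_one_radialIntegral (hΓ.leftMulForm ih))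

theorem fderiv_leftMulForm {Γ : E → E →L[ℝ] A} {F : E → A} {z : E}
    (hΓ : DifferentiableAt ℝ Γ z) (hF : DifferentiableAt ℝ F z) (v w : E) :
    fderiv ℝ (leftMulForm Γ F) z v w = fderiv ℝ F z v * Γ z w + F z * fderiv ℝ Γ z v w := by
  have h1 : HasFDerivAt (fun z => ContinuousLinearMap.mul ℝ A (F z))
      ((ContinuousLinearMap.mul ℝ A).comp (fderiv ℝ F z)) z :=
    (ContinuousLinearMap.mul ℝ A).hasFDerivAt.comp z hF.hasFDerivAt
  have := (h1.clm_comp hΓ.hasFDerivAt).fderiv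
  unfold leftMulForm
  rw [this]
  simp [add_comm]

/-- A linear total differential system `dF = F · Γ` with vanishing curvature is solvable on a
small ball around the origin. -/
theorem exists_hasFDerivAt_leftMulForm (hone : ‖(1 : A)‖ ≤ 1) {Γ : E → E →L[ℝ] A} (hΓ : ContDiff ℝ 1 Γ) {r C : ℝ}
    (hC : 0 ≤ C) (hCr : C * r ≤ 1 / 8) (hbound : ∀ z ∈ Metric.ball (0 : E) r, ‖Γ z‖ ≤ C)
    (hflat : ∀ z ∈ Metric.ball (0 : E) r, ∀ v w,
      fderiv ℝ Γ z v w + Γ z v * Γ z w = fderiv ℝ Γ z w v + Γ z w * Γ z v) :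
    ∃ F : E → A, F 0 = 1 ∧ ∀ x ∈ Metric.ball (0 : E) r, HasFDerivAt F (leftMulForm Γ F x) x := by
  set F := flatIterate Γ with hFdef
  have hF1 : ∀ k, ContDiff ℝ 1 (F k) := contDiff_flatIterate hΓ
  have hFd : ∀ k z, DifferentiableAt ℝ (F k) z := fun k z => (hF1 k).differentiable one_ne_zero z
  have hθ : ∀ k, ContDiff ℝ 1 (leftMulForm Γ (F k)) := fun k => hΓ.leftMulForm (hF1 k)
  have hball : ∀ x ∈ Metric.ball (0 : E) r, ∀ t ∈ Ι (0 : ℝ) 1, t • x ∈ Metric.ball (0 : E) r := by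
    intro x hx t ht
    rw [uIoc_of_le zero_le_one] at ht
    rw [mem_ball_zero_iff] at hx ⊢
    rw [norm_smul, Real.norm_of_nonneg ht.1.le]
    exact (mul_le_of_le_one_left (norm_nonneg _) ht.2).trans_lt hx
  have hCx : ∀ x ∈ Metric.ball (0 : E) r, C * ‖x‖ ≤ 1 / 8 := fun x hx =>
    (mul_le_mul_of_nonneg_left (mem_ball_zero_iff.1 hx).le hC).trans hCr
  have hint : ∀ k x, IntervalIntegrable (fun t : ℝ => leftMulForm Γ (F k) (t • x) x) volume 0 1 :=
    fun k x => by
      have := (hθ k).continuous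
      exact Continuous.intervalIntegrable (by fun_prop) _ _
  -- the iterates converge geometrically
  have hstep : ∀ k, ∀ x ∈ Metric.ball (0 : E) r, ‖F (k + 1) x - F k x‖ ≤ (1 / 2) ^ (k + 1) := by
    intro k
    induction k with
    | zero =>
      intro x hx
      have : F 1 x - F 0 x = ∫ t in (0 : ℝ)..1, leftMulForm Γ (F 0) (t • x) x := by
        change (1 + ∫ t in (0 : ℝ)..1, leftMulForm Γ (F 0) (t • x) x) - 1 = _
        abel
      rw [this]
      have := intervalIntegral.norm_integral_le_of_norm_le_const (a := 0) (b := 1) (C := 1 / 2)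
        (f := fun t : ℝ => leftMulForm Γ (F 0) (t • x) x) fun t ht => by
          have h1 := hbound _ (hball x hx t ht)
          have h2 : leftMulForm Γ (F 0) (t • x) x = Γ (t • x) x := one_mul _
          rw [h2]
          calc _ ≤ ‖Γ (t • x)‖ * ‖x‖ := (Γ (t • x)).le_opNorm x
            _ ≤ C * ‖x‖ := by gcongr
            _ ≤ 1 / 2 := (hCx x hx).trans (by norm_num)
      simpa using this
    | succ k ih =>
      intro x hx
      have : F (k + 2) x - F (k + 1) x = ∫ t in (0 : ℝ)..1,
          (leftMulForm Γ (F (k + 1)) (t • x) x - leftMulForm Γ (F k) (t • x) x) := by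
        rw [intervalIntegral.integral_sub (hint _ _) (hint _ _)]
        change (1 + ∫ t in (0 : ℝ)..1, leftMulForm Γ (F (k + 1)) (t • x) x) -
          (1 + ∫ t in (0 : ℝ)..1, leftMulForm Γ (F k) (t • x) x) = _
        abel
      rw [this]
      have := intervalIntegral.norm_integral_le_of_norm_le_const (a := 0) (b := 1)
        (C := (1 / 2) ^ (k + 1 + 1))
        (f := fun t : ℝ => leftMulForm Γ (F (k + 1)) (t • x) x - leftMulForm Γ (F k) (t • x) x)
        fun t ht => by
          have h1 := hbound _ (hball x hx t ht)
          have h2 := ih _ (hball x hx t ht)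
          rw [leftMulForm_apply, leftMulForm_apply, ← sub_mul]
          calc _ ≤ ‖F (k + 1) (t • x) - F k (t • x)‖ * ‖Γ (t • x) x‖ := norm_mul_le _ _
            _ ≤ (1 / 2) ^ (k + 1) * (C * ‖x‖) := by
              gcongr
              exact ((Γ (t • x)).le_opNorm x).trans (by gcongr)
            _ ≤ (1 / 2) ^ (k + 1) * (1 / 2) := by
              gcongr
              exact (hCx x hx).trans (by norm_num)
            _ = _ := (pow_succ _ _).symm
      simpa using this
  -- the defect `dF k - F k · Γ` tends to zero geometrically
  have hdefect : ∀ k, ∀ x ∈ Metric.ball (0 : E) r,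
      ‖fderiv ℝ (F k) x - leftMulForm Γ (F k) x‖ ≤ 2 * C * (1 / 2) ^ k := by
    intro k
    induction k with
    | zero =>
      intro x hx
      have h0 : fderiv ℝ (F 0) x = 0 := by
        change fderiv ℝ (fun _ => (1 : A)) x = 0
        simp
      have h1 := norm_leftMulForm_le Γ (F 0) x
      have h2 : ‖F 0 x‖ * ‖Γ x‖ ≤ ‖Γ x‖ := mul_le_of_le_one_left (norm_nonneg _) hone
      rw [h0, zero_sub, norm_neg]
      have := hbound x hx
      simp only [pow_zero, mul_one]
      linarith
    | succ k ih =>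
      intro x hx
      have hD : fderiv ℝ (F (k + 1)) x = leftMulForm Γ (F k) x + ∫ t in (0 : ℝ)..1,
          t • ((fderiv ℝ (leftMulForm Γ (F k)) (t • x)).flip x -
            fderiv ℝ (leftMulForm Γ (F k)) (t • x) x) :=
        ((hasFDerivAt_radialIntegral (hθ k) x).const_add 1).fderiv
      have hsplit : fderiv ℝ (F (k + 1)) x - leftMulForm Γ (F (k + 1)) x =
          (leftMulForm Γ (F k) x - leftMulForm Γ (F (k + 1)) x) + ∫ t in (0 : ℝ)..1,
          t • ((fderiv ℝ (leftMulForm Γ (F k)) (t • x)).flip x -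
            fderiv ℝ (leftMulForm Γ (F k)) (t • x) x) := by
        rw [hD]; abel
      -- The defect splits into the change of F · Γ from one iterate to the next and the radial
      -- integral of d(F_k · Γ). Each is at most C / 2^(k+1), which adds up to the claimed bound;
      -- the constant 1/8 in `hCr` is what the second part requires.
      have hA : ‖leftMulForm Γ (F k) x - leftMulForm Γ (F (k + 1)) x‖ ≤ (1 / 2) ^ (k + 1) * C := by
        have : leftMulForm Γ (F k) x - leftMulForm Γ (F (k + 1)) x =
            leftMulForm Γ (fun x => F k x - F (k + 1) x) x := by
          ext v
          simp [leftMulForm_apply, sub_mul]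
        rw [this]
        refine (norm_leftMulForm_le _ _ _).trans ?_
        rw [norm_sub_rev]
        exact mul_le_mul (hstep k x hx) (hbound x hx) (norm_nonneg _) (by positivity)
      have hB := intervalIntegral.norm_integral_le_of_norm_le_const (a := 0) (b := 1)
        (C := C * (1 / 2) ^ (k + 1))
        (f := fun t : ℝ => t • ((fderiv ℝ (leftMulForm Γ (F k)) (t • x)).flip x -
            fderiv ℝ (leftMulForm Γ (F k)) (t • x) x)) fun t ht => by
          have hz := hball x hx t ht
          have h1 := hbound _ hz
          have h2 := ih _ hz
          have h3 := hflat _ hz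
          have ht' := ht
          rw [uIoc_of_le zero_le_one] at ht'
          set z := t • x with hzdef
          have hΓd : DifferentiableAt ℝ Γ z := hΓ.differentiable one_ne_zero z
          set G := fderiv ℝ (F k) z - leftMulForm Γ (F k) z with hG
          -- Flatness enters here: d(F_k · Γ) = dF_k ∧ Γ + F_k dΓ, and the curvature equation
          -- cancels everything except the wedge of the previous defect `G` with Γ. This is what
          -- makes the estimate inductive.
          have hcomm : ∀ v, ((fderiv ℝ (leftMulForm Γ (F k)) z).flip x -
            fderiv ℝ (leftMulForm Γ (F k)) z x) v = G v * Γ z x - G x * Γ z v := by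
            intro v
            have e := h3 v x
            have e' : fderiv ℝ Γ z v x - fderiv ℝ Γ z x v = Γ z x * Γ z v - Γ z v * Γ z x := by
              rw [sub_eq_sub_iff_add_eq_add, e, add_comm]
            rw [_root_.sub_apply, ContinuousLinearMap.flip_apply,
              fderiv_leftMulForm hΓd (hFd k z), fderiv_leftMulForm hΓd (hFd k z)]
            have : fderiv ℝ (F k) z v * Γ z x + F k z * fderiv ℝ Γ z v x -
                (fderiv ℝ (F k) z x * Γ z v + F k z * fderiv ℝ Γ z x v) =
                fderiv ℝ (F k) z v * Γ z x - fderiv ℝ (F k) z x * Γ z v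
                  + F k z * (fderiv ℝ Γ z v x - fderiv ℝ Γ z x v) := by
              rw [mul_sub]; abel
            rw [this, e', hG]
            simp only [_root_.sub_apply, leftMulForm_apply]
            noncomm_ring
          rw [norm_smul, Real.norm_of_nonneg ht'.1.le]
          refine (mul_le_of_le_one_left (norm_nonneg _) ht'.2).trans ?_
          refine ContinuousLinearMap.opNorm_le_bound _ (by positivity) fun v => ?_
          rw [hcomm]
          have hx1 := hCx x hx
          calc _ ≤ ‖G v‖ * ‖Γ z x‖ + ‖G x‖ * ‖Γ z v‖ :=
                (norm_sub_le _ _).trans (add_le_add (norm_mul_le _ _) (norm_mul_le _ _))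
            _ ≤ (‖G‖ * ‖v‖) * (‖Γ z‖ * ‖x‖) + (‖G‖ * ‖x‖) * (‖Γ z‖ * ‖v‖) := by
                gcongr <;> exact ContinuousLinearMap.le_opNorm _ _
            _ = 2 * ‖G‖ * (‖Γ z‖ * ‖x‖) * ‖v‖ := by ring
            _ ≤ 2 * (2 * C * (1 / 2) ^ k) * (1 / 8) * ‖v‖ := by
                gcongr
                exact (mul_le_mul_of_nonneg_right h1 (norm_nonneg _)).trans hx1
            _ = C * (1 / 2) ^ (k + 1) * ‖v‖ := by rw [pow_succ]; ring
      rw [hsplit]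
      refine (norm_add_le _ _).trans ((add_le_add hA hB).trans (le_of_eq ?_))
      simp only [sub_zero, abs_one, mul_one]
      rw [pow_succ]; ring
  have hcauchy : ∀ x ∈ Metric.ball (0 : E) r, ∃ a, Tendsto (fun k => F k x) atTop (𝓝 a) := by
    intro x hx
    refine cauchySeq_tendsto_of_complete
      (cauchySeq_of_le_geometric (1 / 2) (1 / 2) (by norm_num) fun k => ?_)
    rw [dist_comm, dist_eq_norm]
    exact (hstep k x hx).trans (by rw [pow_succ]; linarith)
  classical
  choose! F' hF' using hcauchy
  have hdist : ∀ k, ∀ x ∈ Metric.ball (0 : E) r, ‖F k x - F' x‖ ≤ (1 / 2) ^ k := by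
    intro k x hx
    have := dist_le_of_le_geometric_of_tendsto (1 / 2) (1 / 2) (by norm_num) (fun k => by
      rw [dist_comm, dist_eq_norm]
      exact (hstep k x hx).trans (by rw [pow_succ]; linarith)) (hF' x hx) k
    rw [dist_eq_norm] at this
    refine this.trans (le_of_eq ?_)
    ring
  -- The limit `F'` is unspecified off the ball, and the ball is empty when `r ≤ 0`, so the value at
  -- 0 is prescribed by hand. On the ball this changes nothing, because every iterate equals 1 at 0.
  refine ⟨fun x => if x = 0 then 1 else F' x, by simp, ?_⟩
  have hF0 : ∀ x ∈ Metric.ball (0 : E) r, (if x = 0 then 1 else F' x) = F' x := by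
    intro x hx
    split_ifs with h
    · subst h
      refine tendsto_nhds_unique ?_ (hF' 0 hx)
      have : ∀ k, F k 0 = 1 := fun k => by
        cases k with
        | zero => rfl
        | succ k =>
          change 1 + ∫ t in (0 : ℝ)..1, leftMulForm Γ (F k) (t • 0) 0 = 1
          simp
      simp [this]
    · rfl
  have hderiv : ∀ x ∈ Metric.ball (0 : E) r, HasFDerivAt F' (leftMulForm Γ F' x) x := by
    intro x hx
    refine hasFDerivAt_of_tendstoUniformlyOn Metric.isOpen_ball (l := atTop) (f := F)
      (f' := fun k => fderiv ℝ (F k)) (g' := leftMulForm Γ F') ?_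
      (fun k y _ => (hFd k y).hasFDerivAt) hF' hx
    rw [Metric.tendstoUniformlyOn_iff]
    intro ε hε
    -- The 3C is 2C from the defect of F_k plus C from replacing F_k by its limit in F · Γ.
    have hlim : Tendsto (fun k : ℕ => 3 * C * (1 / 2 : ℝ) ^ k) atTop (𝓝 0) := by
      simpa using (tendsto_pow_atTop_nhds_zero_of_lt_one (by norm_num : (0 : ℝ) ≤ 1 / 2)
        (by norm_num)).const_mul (3 * C)
    filter_upwards [hlim.eventually_lt_const hε] with k hk y hy
    refine lt_of_le_of_lt ?_ hk
    rw [dist_comm, dist_eq_norm]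
    have h1 : fderiv ℝ (F k) y - leftMulForm Γ F' y = (fderiv ℝ (F k) y - leftMulForm Γ (F k) y)
        + leftMulForm Γ (fun x => F k x - F' x) y := by
      ext v
      simp [leftMulForm_apply, sub_mul]
    rw [h1]
    have h2 := hdefect k y hy
    have h3 := (norm_leftMulForm_le Γ (fun x => F k x - F' x) y).trans
      (mul_le_mul (hdist k y hy) (hbound y hy) (norm_nonneg _) (by positivity))
    refine (norm_add_le _ _).trans ?_
    linarith
  intro x hx
  have hev : (fun x => if x = 0 then 1 else F' x) =ᶠ[𝓝 x] F' :=
    Filter.eventuallyEq_of_mem (Metric.isOpen_ball.mem_nhds hx) hF0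
  have : leftMulForm Γ (fun x => if x = 0 then 1 else F' x) x = leftMulForm Γ F' x := by
    simp only [leftMulForm, hF0 x hx]
  rw [this]
  exact (hderiv x hx).congr_of_eventuallyEq hev

/-- The equation bootstraps: if F is Cᵏ, then so is dF = F · Γ, hence F is Cᵏ⁺¹. -/
theorem contDiffOn_of_hasFDerivAt_leftMulForm {Γ : E → E →L[ℝ] A} (hΓ : ContDiff ℝ ∞ Γ)
    {F : E → A} {s : Set E} (hs : IsOpen s) (hF : ∀ x ∈ s, HasFDerivAt F (leftMulForm Γ F x) x) :
    ContDiffOn ℝ ∞ F s := by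
  rw [contDiffOn_infty]
  intro k
  induction k with
  | zero =>
    exact contDiffOn_zero.2 fun x hx => (hF x hx).continuousAt.continuousWithinAt
  | succ k ih =>
    push_cast
    rw [contDiffOn_succ_iff_fderiv_of_isOpen hs]
    refine ⟨fun x hx => (hF x hx).differentiableAt.differentiableWithinAt, by simp, ?_⟩
    refine ContDiffOn.congr (f := leftMulForm Γ F) ?_ fun x hx => (hF x hx).fderiv
    exact ((ContinuousLinearMap.mul ℝ A).contDiff.comp_contDiffOn ih).clm_comp
      (hΓ.of_le (mod_cast le_top)).contDiffOn

end FlatSystem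

/-! ### Flat coordinates in a vector space -/

section FlatCoordinates

variable {E : Type*} [NormedAddCommGroup E] [NormedSpace ℝ E] [FiniteDimensional ℝ E]

/-- Multiplication by a bump function. The system dF = F · Γ was solved for forms defined on the
whole space, whereas Christoffel symbols are controlled only on an open subset of it. -/
theorem exists_contDiff_eventuallyEq {G : Type*} [NormedAddCommGroup G] [NormedSpace ℝ G]
    {f : E → G} {W : Set E} (hW : IsOpen W) (hf : ContDiffOn ℝ ∞ f W) {z : E} (hz : z ∈ W) :
    ∃ g : E → G, ContDiff ℝ ∞ g ∧ ∃ r > 0, Metric.ball z r ⊆ W ∧ EqOn g f (Metric.ball z r) := by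
  obtain ⟨ε, hε, hεW⟩ := Metric.isOpen_iff.1 hW z hz
  let χ : ContDiffBump z := ⟨ε / 4, ε / 2, by positivity, by linarith⟩
  have hsub : Metric.closedBall z χ.rOut ⊆ W := fun y hy =>
    hεW (lt_of_le_of_lt (Metric.mem_closedBall.1 hy) (show ε / 2 < ε by linarith))
  refine ⟨fun y => χ y • f y, ?_, ε / 4, by positivity, ?_, ?_⟩
  · rw [contDiff_iff_contDiffAt]
    intro y
    by_cases hy : y ∈ tsupport χ
    · rw [χ.tsupport_eq] at hy
      exact χ.contDiffAt.smul (hf.contDiffAt (hW.mem_nhds (hsub hy)))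
    · have : (fun y => χ y • f y) =ᶠ[𝓝 y] fun _ => 0 := by
        filter_upwards [notMem_tsupport_iff_eventuallyEq.1 hy] with w hw
        simp [hw]
      exact contDiffAt_const.congr_of_eventuallyEq this
  · exact fun y hy => hεW (lt_trans (Metric.mem_ball.1 hy) (by linarith))
  · intro y hy
    have : χ y = 1 := χ.one_of_mem_closedBall (Metric.ball_subset_closedBall hy)
    simp [this]

/-- A smooth symmetric connection form `Γ` with vanishing curvature on an open subset of a
finite-dimensional space admits local flat coordinates `φ`, i.e. `D²φ(v, w) = Dφ(Γ(v, w))`. -/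
theorem exists_flat_coordinates {Γ : E → E →L[ℝ] E →L[ℝ] E} {W : Set E} (hW : IsOpen W)
    (hΓ : ContDiffOn ℝ ∞ Γ W) (hsymm : ∀ z ∈ W, ∀ v w, Γ z v w = Γ z w v)
    (hflat : ∀ z ∈ W, ∀ v w l,
      fderiv ℝ Γ z v w l + Γ z v (Γ z w l) = fderiv ℝ Γ z w v l + Γ z w (Γ z v l))
    {z₀ : E} (hz₀ : z₀ ∈ W) :
    ∃ φ : E → E, ∃ r > 0, Metric.ball z₀ r ⊆ W ∧ ContDiffOn ℝ ∞ φ (Metric.ball z₀ r) ∧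
      φ z₀ = 0 ∧ fderiv ℝ φ z₀ = ContinuousLinearMap.id ℝ E ∧
      ∀ z ∈ Metric.ball z₀ r, ∀ v w, fderiv ℝ (fderiv ℝ φ) z v w = fderiv ℝ φ z (Γ z v w) := by
  obtain ⟨g, hg, ρ, hρ, hρW, hgΓ⟩ := exists_contDiff_eventuallyEq hW hΓ hz₀
  set Γ' : E → E →L[ℝ] E →L[ℝ] E := fun z => g (z₀ + z) with hΓ'
  have hΓ's : ContDiff ℝ ∞ Γ' := hg.comp (contDiff_const.add contDiff_id)
  have hmem : ∀ {s : ℝ} {z : E}, z ∈ Metric.ball (0 : E) s → z₀ + z ∈ Metric.ball z₀ s := by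
    intro s z hz
    simpa [Metric.mem_ball, dist_eq_norm] using hz
  have hΓ'eq : ∀ z ∈ Metric.ball (0 : E) ρ, Γ' z = Γ (z₀ + z) := fun z hz => hgΓ (hmem hz)
  have hΓ'd : ∀ z ∈ Metric.ball (0 : E) ρ, fderiv ℝ Γ' z = fderiv ℝ Γ (z₀ + z) := by
    intro z hz
    have h1 : Γ' =ᶠ[𝓝 z] fun z => Γ (z₀ + z) :=
      Filter.eventuallyEq_of_mem (Metric.isOpen_ball.mem_nhds hz) hΓ'eq
    rw [h1.fderiv_eq]
    exact fderiv_comp_add_left (𝕜 := ℝ) (f := Γ) (x := z) z₀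
  have hnorm : Continuous fun z => ‖Γ' z‖ := (continuous_norm (E := E →L[ℝ] E →L[ℝ] E)).comp hΓ's.continuous
  obtain ⟨C, hC⟩ := (isCompact_closedBall (0 : E) ρ).exists_bound_of_continuousOn
    hnorm.continuousOn
  replace hC : ∀ z ∈ Metric.closedBall (0 : E) ρ, ‖Γ' z‖ ≤ C :=
    fun z hz => (le_abs_self _).trans (hC z hz)
  have hC0 : 0 ≤ C := (norm_nonneg (Γ' 0)).trans (hC 0 (Metric.mem_closedBall_self hρ.le))
  -- Small enough for `C * r ≤ 1 / 8`; the `+ 1` keeps the denominator positive when C = 0.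
  set r := min ρ (1 / (8 * (C + 1))) with hr
  have hr0 : 0 < r := lt_min hρ (by positivity)
  have hrρ : Metric.ball (0 : E) r ⊆ Metric.ball 0 ρ := Metric.ball_subset_ball (min_le_left _ _)
  have hCr : C * r ≤ 1 / 8 := by
    calc C * r ≤ C * (1 / (8 * (C + 1))) := by gcongr; exact min_le_right _ _
      _ = (C / (C + 1)) * (1 / 8) := by field_simp
      _ ≤ 1 * (1 / 8) := by
        gcongr
        exact (div_le_one (by positivity)).2 (by linarith)
      _ = 1 / 8 := one_mul _
  -- Multiplication in `E →L[ℝ] E` is composition, so the curvature hypothesis is the integrability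
  -- condition of the system. Only ‖id‖ ≤ 1 is available, since `E` may be zero-dimensional.
  obtain ⟨F, hF0, hF⟩ := exists_hasFDerivAt_leftMulForm (A := E →L[ℝ] E)
    ContinuousLinearMap.norm_id_le (hΓ's.of_le (mod_cast le_top)) hC0 hCr
    (fun z hz => hC z (Metric.ball_subset_closedBall (hrρ hz))) fun z hz v w => by
      ext1 l
      have := hflat (z₀ + z) (hρW (hmem (hrρ hz))) v w l
      rw [hΓ'eq z (hrρ hz), hΓ'd z (hrρ hz)]
      exact this
  have hFs : ContDiffOn ℝ ∞ F (Metric.ball 0 r) :=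
    contDiffOn_of_hasFDerivAt_leftMulForm hΓ's Metric.isOpen_ball hF
  -- Poincaré lemma for the E-valued 1-form F: its derivative (v, w) ↦ F(Γ(v, w)) is symmetric
  -- because Γ is torsion-free, so F is closed and therefore a differential on the ball.
  obtain ⟨ψ, hψ⟩ := (convex_ball (0 : E) r).exists_forall_hasFDerivAt_of_fderiv_symmetric
    Metric.isOpen_ball (show DifferentiableOn ℝ F _ from
      fun x hx => (hF x hx).differentiableAt.differentiableWithinAt)
    fun z hz v w => by
      rw [(hF z hz).fderiv, leftMulForm_apply, leftMulForm_apply, hΓ'eq z (hrρ hz)]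
      change F z (Γ (z₀ + z) v w) = F z (Γ (z₀ + z) w v)
      rw [hsymm _ (hρW (hmem (hrρ hz)))]
  have hsub : ∀ {z : E}, z ∈ Metric.ball z₀ r → z - z₀ ∈ Metric.ball (0 : E) r := by
    intro z hz
    simpa [Metric.mem_ball, dist_eq_norm] using hz
  have hφ : ∀ z ∈ Metric.ball z₀ r,
      HasFDerivAt (fun z => ψ (z - z₀) - ψ 0) (F (z - z₀)) z := fun z hz => by
    have := (hψ _ (hsub hz)).comp z ((hasFDerivAt_id z).sub_const z₀)
    simpa using! this.sub_const (ψ 0)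
  have hFz : ContDiffOn ℝ ∞ (fun z => F (z - z₀)) (Metric.ball z₀ r) :=
    hFs.comp (contDiff_id.sub contDiff_const).contDiffOn fun z hz => hsub hz
  refine ⟨fun z => ψ (z - z₀) - ψ 0, r, hr0, ?_, ?_, by simp, ?_, ?_⟩
  · exact (Metric.ball_subset_ball (min_le_left _ _)).trans hρW
  · rw [contDiffOn_infty_iff_fderiv_of_isOpen Metric.isOpen_ball]
    exact ⟨fun z hz => (hφ z hz).differentiableAt.differentiableWithinAt,
      hFz.congr fun z hz => (hφ z hz).fderiv⟩
  · rw [(hφ z₀ (Metric.mem_ball_self hr0)).fderiv, sub_self, hF0]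
    rfl
  · intro z hz v w
    have h1 : fderiv ℝ (fun z => ψ (z - z₀) - ψ 0) =ᶠ[𝓝 z] fun z => F (z - z₀) :=
      Filter.eventuallyEq_of_mem (Metric.isOpen_ball.mem_nhds hz) fun z hz => (hφ z hz).fderiv
    have h2 : HasFDerivAt (fun z => F (z - z₀)) (leftMulForm Γ' F (z - z₀)) z := by
      have := (hF _ (hsub hz)).comp z ((hasFDerivAt_id z).sub_const z₀)
      simpa using! this
    rw [h1.fderiv_eq, h2.fderiv, leftMulForm_apply, (hφ z hz).fderiv,
      hΓ'eq _ (hrρ (hsub hz)), add_sub_cancel]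
    rfl

end FlatCoordinates

end

/-! ### Functions and tangent vectors read in a coordinate system -/

namespace ConstCoeff
open Filter Topology Set

variable {n : ℕ} {M : Type*} [TopologicalSpace M] [ChartedSpace (EuclideanSpace ℝ (Fin n)) M]
variable {u : OpenPartialHomeomorph M (EuclideanSpace ℝ (Fin n))}

/-- The differential of the coordinate system `u`, with values in the model space. -/
def coordDiff (u : OpenPartialHomeomorph M (EuclideanSpace ℝ (Fin n))) (y : M) :
    TangentSpace (𝓡 n) y →L[ℝ] EuclideanSpace ℝ (Fin n) :=
  mvfderiv (𝓡 n) u y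

/-- The differential of the inverse of the coordinate system `u`. -/
def coordLift (u : OpenPartialHomeomorph M (EuclideanSpace ℝ (Fin n))) (y : M) :
    EuclideanSpace ℝ (Fin n) →L[ℝ] TangentSpace (𝓡 n) y :=
  mfderiv (𝓡 n) (𝓡 n) u.symm (u y)

theorem coordField_eq_coordLift (u : OpenPartialHomeomorph M (EuclideanSpace ℝ (Fin n)))
    (i : Fin n) (y : M) : coordField u i y = coordLift u y (EuclideanSpace.single i 1) := rfl

/-- The coordinate representation of the vector field `X`. -/
def fieldRep (u : OpenPartialHomeomorph M (EuclideanSpace ℝ (Fin n)))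
    (X : ∀ y : M, TangentSpace (𝓡 n) y) (z : EuclideanSpace ℝ (Fin n)) :
    EuclideanSpace ℝ (Fin n) :=
  coordDiff u (u.symm z) (X (u.symm z))

theorem fieldRep_apply {X : ∀ y : M, TangentSpace (𝓡 n) y} {y : M} (hy : y ∈ u.source) :
    fieldRep u X (u y) = coordDiff u y (X y) := by
  rw [fieldRep, u.left_inv hy]

section

variable [IsManifold (𝓡 n) ∞ M]

theorem contMDiffAt_coord (hu : u ∈ coordinateSystems n M) {y : M} (hy : y ∈ u.source) :
    ContMDiffAt (𝓡 n) (𝓡 n) ∞ u y :=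
  contMDiffAt_of_mem_maximalAtlas hu hy

theorem contMDiffAt_coord_symm (hu : u ∈ coordinateSystems n M)
    {z : EuclideanSpace ℝ (Fin n)} (hz : z ∈ u.target) :
    ContMDiffAt (𝓡 n) (𝓡 n) ∞ u.symm z :=
  contMDiffAt_symm_of_mem_maximalAtlas hu hz

theorem mdifferentiableAt_coord (hu : u ∈ coordinateSystems n M) {y : M} (hy : y ∈ u.source) :
    MDifferentiableAt (𝓡 n) (𝓡 n) u y :=
  (contMDiffAt_coord hu hy).mdifferentiableAt (by simp)

theorem mdifferentiableAt_coord_symm (hu : u ∈ coordinateSystems n M)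
    {z : EuclideanSpace ℝ (Fin n)} (hz : z ∈ u.target) :
    MDifferentiableAt (𝓡 n) (𝓡 n) u.symm z :=
  (contMDiffAt_coord_symm hu hz).mdifferentiableAt (by simp)

theorem coordLift_coordDiff (hu : u ∈ coordinateSystems n M) {y : M} (hy : y ∈ u.source)
    (v : TangentSpace (𝓡 n) y) : coordLift u y (coordDiff u y v) = v := by
  have h := mfderiv_comp y (mdifferentiableAt_coord_symm hu (u.map_source hy))
    (mdifferentiableAt_coord hu hy)
  have h2 : u.symm ∘ u =ᶠ[𝓝 y] id := u.eventually_left_inverse hy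
  rw [h2.mfderiv_eq, mfderiv_id] at h
  exact (congrArg (fun L => L v) h).symm

theorem coordDiff_coordLift (hu : u ∈ coordinateSystems n M) {y : M} (hy : y ∈ u.source)
    (v : EuclideanSpace ℝ (Fin n)) : coordDiff u y (coordLift u y v) = v := by
  have hz := u.map_source hy
  have h := mfderiv_comp_of_eq (x := u y) (mdifferentiableAt_coord hu hy)
    (mdifferentiableAt_coord_symm hu hz) (u.left_inv hy)
  have h2 : u ∘ u.symm =ᶠ[𝓝 (u y)] id := u.eventually_right_inverse hz
  rw [h2.mfderiv_eq, mfderiv_id, u.left_inv hy] at h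
  exact (congrArg (fun L => L v) h).symm

theorem coordDiff_injective (hu : u ∈ coordinateSystems n M) {y : M} (hy : y ∈ u.source) :
    Function.Injective (coordDiff u y) :=
  Function.LeftInverse.injective (coordLift_coordDiff hu hy)

theorem coordForm_apply (hu : u ∈ coordinateSystems n M) {y : M} (hy : y ∈ u.source)
    (i : Fin n) (v : TangentSpace (𝓡 n) y) : coordForm u i y v = coordDiff u y v i := by
  have h := mfderiv_comp y (I'' := 𝓘(ℝ, ℝ))
    ((EuclideanSpace.proj i : EuclideanSpace ℝ (Fin n) →L[ℝ] ℝ).differentiableAt.mdifferentiableAt)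
    (mdifferentiableAt_coord hu hy)
  rw [mfderiv_eq_fderiv, ContinuousLinearMap.fderiv] at h
  exact congrArg (fun L => L v) h

theorem coordForm_eq (hu : u ∈ coordinateSystems n M) {y : M} (hy : y ∈ u.source)
    (i : Fin n) : coordForm u i y = (EuclideanSpace.proj i).comp (coordDiff u y) :=
  ContinuousLinearMap.ext fun v => coordForm_apply hu hy i v

theorem coordDiff_coordField (hu : u ∈ coordinateSystems n M) {y : M} (hy : y ∈ u.source)
    (i : Fin n) : coordDiff u y (coordField u i y) = EuclideanSpace.single i 1 :=
  coordDiff_coordLift hu hy _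

theorem sum_smul_coordField (u : OpenPartialHomeomorph M (EuclideanSpace ℝ (Fin n))) (y : M)
    (w : EuclideanSpace ℝ (Fin n)) : ∑ i, w i • coordField u i y = coordLift u y w := by
  simp_rw [coordField_eq_coordLift, ← map_smul, ← map_sum]
  congr 1
  ext j
  simp [Finset.sum_apply, Pi.single_apply]

theorem sum_coordForm_smul_coordField (hu : u ∈ coordinateSystems n M) {y : M}
    (hy : y ∈ u.source) (v : TangentSpace (𝓡 n) y) :
    ∑ i, coordForm u i y v • coordField u i y = v := by
  simp_rw [coordForm_apply hu hy]
  rw [sum_smul_coordField, coordLift_coordDiff hu hy]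

variable {G : Type*} [NormedAddCommGroup G] [NormedSpace ℝ G]

theorem contMDiffAt_iff_comp_symm (hu : u ∈ coordinateSystems n M) {y : M} (hy : y ∈ u.source)
    {f : M → G} :
    ContMDiffAt (𝓡 n) 𝓘(ℝ, G) ∞ f y ↔ ContDiffAt ℝ ∞ (f ∘ u.symm) (u y) := by
  have hz := u.map_source hy
  rw [← contMDiffAt_iff_contDiffAt]
  refine ⟨fun h => ?_, fun h => ?_⟩
  · exact ContMDiffAt.comp_of_eq h (contMDiffAt_coord_symm hu hz) (u.left_inv hy)
  · refine (ContMDiffAt.comp y h (contMDiffAt_coord hu hy)).congr_of_eventuallyEq ?_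
    filter_upwards [u.eventually_left_inverse hy] with w hw
    simp [hw]

theorem mdifferentiableAt_iff_comp_symm (hu : u ∈ coordinateSystems n M) {y : M}
    (hy : y ∈ u.source) {f : M → G} :
    MDifferentiableAt (𝓡 n) 𝓘(ℝ, G) f y ↔ DifferentiableAt ℝ (f ∘ u.symm) (u y) := by
  have hz := u.map_source hy
  rw [← mdifferentiableAt_iff_differentiableAt]
  refine ⟨fun h => ?_, fun h => ?_⟩
  · exact MDifferentiableAt.comp_of_eq (u y) h (mdifferentiableAt_coord_symm hu hz) (u.left_inv hy)
  · refine (MDifferentiableAt.comp y h (mdifferentiableAt_coord hu hy)).congr_of_eventuallyEq ?_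
    filter_upwards [u.eventually_left_inverse hy] with w hw
    simp [hw]

theorem mvfderiv_apply_eq_fderiv (hu : u ∈ coordinateSystems n M) {y : M} (hy : y ∈ u.source)
    {f : M → G} (hf : MDifferentiableAt (𝓡 n) 𝓘(ℝ, G) f y) (v : TangentSpace (𝓡 n) y) :
    mvfderiv (𝓡 n) f y v = fderiv ℝ (f ∘ u.symm) (u y) (coordDiff u y v) := by
  have h1 := ((mdifferentiableAt_iff_comp_symm hu hy).1 hf).mdifferentiableAt
  have h := mfderiv_comp y h1 (mdifferentiableAt_coord hu hy)
  have h2 : (f ∘ u.symm) ∘ u =ᶠ[𝓝 y] f := by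
    filter_upwards [u.eventually_left_inverse hy] with w hw
    simp [hw]
  rw [h2.mfderiv_eq, mfderiv_eq_fderiv] at h
  exact congrArg (fun L => L v) h

/-! ### Vector fields in coordinates -/

theorem isInvertible_mfderiv_coord (hu : u ∈ coordinateSystems n M) {y : M}
    (hy : y ∈ u.source) : (mfderiv (𝓡 n) (𝓡 n) u y).IsInvertible :=
  ContinuousLinearMap.IsInvertible.of_inverse (g := coordLift u y)
    (ContinuousLinearMap.ext fun v => coordDiff_coordLift hu hy v)
    (ContinuousLinearMap.ext fun v => coordLift_coordDiff hu hy v)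

theorem inverse_mfderiv_coord (hu : u ∈ coordinateSystems n M) {y : M}
    (hy : y ∈ u.source) : (mfderiv (𝓡 n) (𝓡 n) u y).inverse = coordLift u y :=
  ContinuousLinearMap.inverse_eq
    (ContinuousLinearMap.ext fun v => coordDiff_coordLift hu hy v)
    (ContinuousLinearMap.ext fun v => coordLift_coordDiff hu hy v)

theorem mfderiv_symm_coordDiff (hu : u ∈ coordinateSystems n M)
    {z : EuclideanSpace ℝ (Fin n)} (hz : z ∈ u.target) (v : TangentSpace (𝓡 n) (u.symm z)) :
    mfderiv (𝓡 n) (𝓡 n) u.symm z (coordDiff u (u.symm z) v) = v := by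
  have := coordLift_coordDiff hu (u.map_target hz) v
  rwa [coordLift, u.right_inv hz] at this

theorem coordDiff_mfderiv_symm (hu : u ∈ coordinateSystems n M)
    {z : EuclideanSpace ℝ (Fin n)} (hz : z ∈ u.target) (v : EuclideanSpace ℝ (Fin n)) :
    coordDiff u (u.symm z) (mfderiv (𝓡 n) (𝓡 n) u.symm z v) = v := by
  have := coordDiff_coordLift hu (u.map_target hz) v
  rwa [coordLift, u.right_inv hz] at this

theorem isInvertible_mfderiv_coord_symm (hu : u ∈ coordinateSystems n M)
    {z : EuclideanSpace ℝ (Fin n)} (hz : z ∈ u.target) :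
    (mfderiv (𝓡 n) (𝓡 n) u.symm z).IsInvertible :=
  ContinuousLinearMap.IsInvertible.of_inverse (g := coordDiff u (u.symm z))
    (ContinuousLinearMap.ext fun v => mfderiv_symm_coordDiff hu hz v)
    (ContinuousLinearMap.ext fun v => coordDiff_mfderiv_symm hu hz v)

theorem inverse_mfderiv_coord_symm (hu : u ∈ coordinateSystems n M)
    {z : EuclideanSpace ℝ (Fin n)} (hz : z ∈ u.target) :
    (mfderiv (𝓡 n) (𝓡 n) u.symm z).inverse = coordDiff u (u.symm z) :=
  ContinuousLinearMap.inverse_eq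
    (ContinuousLinearMap.ext fun v => mfderiv_symm_coordDiff hu hz v)
    (ContinuousLinearMap.ext fun v => coordDiff_mfderiv_symm hu hz v)

theorem two_le_infty : (2 : ℕ∞ω) ≤ ∞ := ENat.LEInfty.out

/-- The tangent bundle of a vector space is a product, so the section is tested by its second
component. -/
theorem mdifferentiableAt_vectorSpace_iff {F : Type*} [NormedAddCommGroup F] [NormedSpace ℝ F]
    {X : ∀ z : F, TangentSpace 𝓘(ℝ, F) z} {z : F} :
    MDifferentiableAt 𝓘(ℝ, F) 𝓘(ℝ, F).tangent
      (fun z => (⟨z, X z⟩ : TangentBundle 𝓘(ℝ, F) F)) z ↔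
      DifferentiableAt ℝ (fun z => (X z : F)) z := by
  refine ⟨fun h => ?_, fun h => ?_⟩
  · have := ((contMDiff_snd_tangentBundle_modelSpace F 𝓘(ℝ, F) (n := 1)).contMDiffAt
      |>.mdifferentiableAt one_ne_zero).comp z h
    exact mdifferentiableAt_iff_differentiableAt.1 this
  · apply (mdifferentiableAt_totalSpace _ _).2
    refine ⟨mdifferentiableAt_id, ?_⟩
    convert! h.mdifferentiableAt with y
    simp

/-- The coordinate representation of a vector field, as a vector field on the model space. -/
def repField (u : OpenPartialHomeomorph M (EuclideanSpace ℝ (Fin n)))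
    (X : ∀ y : M, TangentSpace (𝓡 n) y) (z : EuclideanSpace ℝ (Fin n)) :
    TangentSpace (𝓡 n) z :=
  fieldRep u X z

/-- Presenting fields as pullbacks along `u` gives access to the naturality of pullbacks, both for
regularity and for the Lie bracket. -/
theorem eq_mpullback_repField (hu : u ∈ coordinateSystems n M) {y : M} (hy : y ∈ u.source)
    (X : ∀ y : M, TangentSpace (𝓡 n) y) :
    X y = VectorField.mpullback (𝓡 n) (𝓡 n) u (repField u X) y := by
  rw [VectorField.mpullback_apply, inverse_mfderiv_coord hu hy, repField, fieldRep_apply hy]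
  exact (coordLift_coordDiff hu hy _).symm

theorem repField_eq_mpullback (hu : u ∈ coordinateSystems n M) {z : EuclideanSpace ℝ (Fin n)}
    (hz : z ∈ u.target) (X : ∀ y : M, TangentSpace (𝓡 n) y) :
    repField u X z = VectorField.mpullback (𝓡 n) (𝓡 n) u.symm X z := by
  rw [VectorField.mpullback_apply, inverse_mfderiv_coord_symm hu hz]
  rfl

theorem contMDiffAt_field_iff (hu : u ∈ coordinateSystems n M) {y : M} (hy : y ∈ u.source)
    {X : ∀ y : M, TangentSpace (𝓡 n) y} :
    ContMDiffAt (𝓡 n) (𝓡 n).tangent ∞ (fun y => (⟨y, X y⟩ : TangentBundle (𝓡 n) M)) y ↔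
      ContDiffAt ℝ ∞ (fieldRep u X) (u y) := by
  have hz := u.map_source hy
  refine Iff.trans ?_ (contMDiffAt_vectorSpace_iff_contDiffAt (V := repField u X))
  refine ⟨fun h => ?_, fun h => ?_⟩
  · rw [← u.left_inv hy] at h
    have := h.mpullback_vectorField_preimage (f := u.symm) (contMDiffAt_coord_symm hu hz)
      (isInvertible_mfderiv_coord_symm hu hz) (mod_cast le_top)
    refine this.congr_of_eventuallyEq ?_
    filter_upwards [u.open_target.mem_nhds hz] with w hw
    rw [repField_eq_mpullback hu hw]
  · have := ContMDiffAt.mpullback_vectorField_preimage (f := u) h (contMDiffAt_coord hu hy)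
      (isInvertible_mfderiv_coord hu hy) (mod_cast le_top)
    refine this.congr_of_eventuallyEq ?_
    filter_upwards [u.open_source.mem_nhds hy] with w hw
    rw [eq_mpullback_repField hu hw X]

theorem mdifferentiableAt_field_iff_repField (hu : u ∈ coordinateSystems n M) {y : M}
    (hy : y ∈ u.source) {X : ∀ y : M, TangentSpace (𝓡 n) y} :
    MDifferentiableAt (𝓡 n) (𝓡 n).tangent (fun y => (⟨y, X y⟩ : TangentBundle (𝓡 n) M)) y ↔
      MDifferentiableAt (𝓡 n) (𝓡 n).tangent
        (fun z => (⟨z, repField u X z⟩ : TangentBundle (𝓡 n) (EuclideanSpace ℝ (Fin n)))) (u y) := by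
  have hz := u.map_source hy
  have : IsManifold (𝓡 n) 2 M := IsManifold.of_le two_le_infty
  refine ⟨fun h => ?_, fun h => ?_⟩
  · rw [← u.left_inv hy] at h
    have := h.mpullback_vectorField (f := u.symm) (contMDiffAt_coord_symm hu hz)
      (isInvertible_mfderiv_coord_symm hu hz) two_le_infty
    refine this.congr_of_eventuallyEq ?_
    filter_upwards [u.open_target.mem_nhds hz] with w hw
    rw [repField_eq_mpullback hu hw]
  · have := MDifferentiableAt.mpullback_vectorField (f := u) h (contMDiffAt_coord hu hy)
      (isInvertible_mfderiv_coord hu hy) two_le_infty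
    refine this.congr_of_eventuallyEq ?_
    filter_upwards [u.open_source.mem_nhds hy] with w hw
    rw [eq_mpullback_repField hu hw X]

theorem mdifferentiableAt_field_iff (hu : u ∈ coordinateSystems n M) {y : M} (hy : y ∈ u.source)
    {X : ∀ y : M, TangentSpace (𝓡 n) y} :
    MDifferentiableAt (𝓡 n) (𝓡 n).tangent (fun y => (⟨y, X y⟩ : TangentBundle (𝓡 n) M)) y ↔
      DifferentiableAt ℝ (fieldRep u X) (u y) :=
  (mdifferentiableAt_field_iff_repField hu hy).trans mdifferentiableAt_vectorSpace_iff

/-- Naturality of the bracket under pullback by `u` reduces it to the bracket of vector-valued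
functions on the model space. -/
theorem coordDiff_mlieBracket (hu : u ∈ coordinateSystems n M) {y : M} (hy : y ∈ u.source)
    {X Y : ∀ y : M, TangentSpace (𝓡 n) y}
    (hX : MDifferentiableAt (𝓡 n) (𝓡 n).tangent (fun y => (⟨y, X y⟩ : TangentBundle (𝓡 n) M)) y)
    (hY : MDifferentiableAt (𝓡 n) (𝓡 n).tangent (fun y => (⟨y, Y y⟩ : TangentBundle (𝓡 n) M)) y) :
    coordDiff u y (VectorField.mlieBracket (𝓡 n) X Y y) =
      fderiv ℝ (fieldRep u Y) (u y) (coordDiff u y (X y)) -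
        fderiv ℝ (fieldRep u X) (u y) (coordDiff u y (Y y)) := by
  have : IsManifold (𝓡 n) 2 M := IsManifold.of_le two_le_infty
  have : IsManifold (𝓡 n) (minSmoothness ℝ 2) M := by simpa
  have hX' : X =ᶠ[𝓝 y] VectorField.mpullback (𝓡 n) (𝓡 n) u (repField u X) := by
    filter_upwards [u.open_source.mem_nhds hy] with w hw using eq_mpullback_repField hu hw X
  have hY' : Y =ᶠ[𝓝 y] VectorField.mpullback (𝓡 n) (𝓡 n) u (repField u Y) := by
    filter_upwards [u.open_source.mem_nhds hy] with w hw using eq_mpullback_repField hu hw Y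
  rw [hX'.mlieBracket_vectorField_eq hY', ← VectorField.mpullback_mlieBracket
    ((mdifferentiableAt_field_iff_repField hu hy).1 hX)
    ((mdifferentiableAt_field_iff_repField hu hy).1 hY) (contMDiffAt_coord hu hy)
    (by simpa using two_le_infty), VectorField.mpullback_apply, inverse_mfderiv_coord hu hy]
  refine (coordDiff_coordLift hu hy _).trans ?_
  rw [← VectorField.mlieBracketWithin_univ, VectorField.mlieBracketWithin_eq_lieBracketWithin]
  refine (congrFun (VectorField.lieBracketWithin_univ (𝕜 := ℝ) (V := fieldRep u X)
    (W := fieldRep u Y)) (u y)).trans ?_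
  rw [← fieldRep_apply hy, ← fieldRep_apply hy]
  rfl

end
end ConstCoeff

/-! ### The connection of a coordinate system -/

namespace ConstCoeff
open Filter Topology Set

variable {n : ℕ} {M : Type*} [TopologicalSpace M] [ChartedSpace (EuclideanSpace ℝ (Fin n)) M]
variable {u : OpenPartialHomeomorph M (EuclideanSpace ℝ (Fin n))}
section
variable [IsManifold (𝓡 n) ∞ M]

/-- The vector field `X` is differentiable at `y`. -/
abbrev FieldDiffAt (X : ∀ y : M, TangentSpace (𝓡 n) y) (y : M) : Prop :=
  MDifferentiableAt (𝓡 n) (𝓡 n).tangent (fun y => (⟨y, X y⟩ : TangentBundle (𝓡 n) M)) y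

/-- The vector field `X` is smooth at `y`. -/
abbrev FieldSmoothAt (X : ∀ y : M, TangentSpace (𝓡 n) y) (y : M) : Prop :=
  ContMDiffAt (𝓡 n) (𝓡 n).tangent ∞ (fun y => (⟨y, X y⟩ : TangentBundle (𝓡 n) M)) y

theorem FieldSmoothAt.fieldDiffAt {X : ∀ y : M, TangentSpace (𝓡 n) y} {y : M}
    (h : FieldSmoothAt X y) : FieldDiffAt X y :=
  ContMDiffAt.mdifferentiableAt h (by simp)

theorem SmoothVectorFieldOn.fieldSmoothAt {X : ∀ y : M, TangentSpace (𝓡 n) y} {U : Set M}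
    (h : SmoothVectorFieldOn X U) (hU : IsOpen U) {y : M} (hy : y ∈ U) : FieldSmoothAt X y :=
  ContMDiffOn.contMDiffAt h (hU.mem_nhds hy)

theorem SmoothVectorFieldOn.of_forall {X : ∀ y : M, TangentSpace (𝓡 n) y} {U : Set M}
    (h : ∀ y ∈ U, FieldSmoothAt X y) : SmoothVectorFieldOn X U :=
  fun y hy => (h y hy).contMDiffWithinAt

theorem fieldRep_coordField (hu : u ∈ coordinateSystems n M) {z : EuclideanSpace ℝ (Fin n)}
    (hz : z ∈ u.target) (i : Fin n) :
    fieldRep u (coordField u i) z = EuclideanSpace.single i 1 :=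
  coordDiff_coordField hu (u.map_target hz) i

theorem fieldRep_coordField_eventuallyEq (hu : u ∈ coordinateSystems n M) {y : M}
    (hy : y ∈ u.source) (i : Fin n) :
    fieldRep u (coordField u i) =ᶠ[𝓝 (u y)] fun _ => EuclideanSpace.single i 1 := by
  filter_upwards [u.open_target.mem_nhds (u.map_source hy)] with z hz
    using fieldRep_coordField hu hz i

theorem fieldSmoothAt_coordField (hu : u ∈ coordinateSystems n M) {y : M}
    (hy : y ∈ u.source) (i : Fin n) : FieldSmoothAt (coordField u i) y :=
  (contMDiffAt_field_iff hu hy).2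
    (contDiffAt_const.congr_of_eventuallyEq (fieldRep_coordField_eventuallyEq hu hy i))

theorem smoothVectorFieldOn_coordField (hu : u ∈ coordinateSystems n M) (i : Fin n) :
    SmoothVectorFieldOn (coordField u i) u.source :=
  SmoothVectorFieldOn.of_forall fun _ hy => fieldSmoothAt_coordField hu hy i

theorem coordForm_comp_symm_eventuallyEq (hu : u ∈ coordinateSystems n M) {y : M}
    (hy : y ∈ u.source) (Y : ∀ y : M, TangentSpace (𝓡 n) y) (i : Fin n) :
    (fun z => coordForm u i z (Y z)) ∘ u.symm =ᶠ[𝓝 (u y)] fun z => fieldRep u Y z i := by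
  filter_upwards [u.open_target.mem_nhds (u.map_source hy)] with z hz
  exact coordForm_apply hu (u.map_target hz) i _

theorem mdifferentiableAt_coordForm_apply (hu : u ∈ coordinateSystems n M) {y : M}
    (hy : y ∈ u.source) {Y : ∀ y : M, TangentSpace (𝓡 n) y} (hY : FieldDiffAt Y y) (i : Fin n) :
    MDifferentiableAt (𝓡 n) 𝓘(ℝ, ℝ) (fun z => coordForm u i z (Y z)) y := by
  rw [mdifferentiableAt_iff_comp_symm hu hy]
  refine DifferentiableAt.congr_of_eventuallyEq ?_ (coordForm_comp_symm_eventuallyEq hu hy Y i)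
  exact (EuclideanSpace.proj i : EuclideanSpace ℝ (Fin n) →L[ℝ] ℝ).differentiableAt.comp _
    ((mdifferentiableAt_field_iff hu hy).1 hY)

theorem mvfderiv_coordForm_apply (hu : u ∈ coordinateSystems n M) {y : M}
    (hy : y ∈ u.source) {Y : ∀ y : M, TangentSpace (𝓡 n) y} (hY : FieldDiffAt Y y) (i : Fin n)
    (v : TangentSpace (𝓡 n) y) :
    mvfderiv (𝓡 n) (fun z => coordForm u i z (Y z)) y v =
      fderiv ℝ (fieldRep u Y) (u y) (coordDiff u y v) i := by
  rw [mvfderiv_apply_eq_fderiv hu hy (mdifferentiableAt_coordForm_apply hu hy hY i),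
    (coordForm_comp_symm_eventuallyEq hu hy Y i).fderiv_eq]
  have := (EuclideanSpace.proj i : EuclideanSpace ℝ (Fin n) →L[ℝ] ℝ).hasFDerivAt.comp (u y)
    ((mdifferentiableAt_field_iff hu hy).1 hY).hasFDerivAt
  have h2 := this.fderiv
  exact congrArg (fun L => L (coordDiff u y v)) h2

/-- The connection of a coordinate system is the derivative in these coordinates. -/
theorem coordConnection_apply (hu : u ∈ coordinateSystems n M) {y : M}
    (hy : y ∈ u.source) {Y : ∀ y : M, TangentSpace (𝓡 n) y} (hY : FieldDiffAt Y y)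
    (v : TangentSpace (𝓡 n) y) :
    coordConnection u Y y v =
      coordLift u y (fderiv ℝ (fieldRep u Y) (u y) (coordDiff u y v)) := by
  rw [← sum_smul_coordField, coordConnection, _root_.sum_apply]
  exact Finset.sum_congr rfl fun i _ => by
    rw [ContinuousLinearMap.smulRight_apply, mvfderiv_coordForm_apply hu hy hY]

theorem coordDiff_coordConnection (hu : u ∈ coordinateSystems n M) {y : M}
    (hy : y ∈ u.source) {Y : ∀ y : M, TangentSpace (𝓡 n) y} (hY : FieldDiffAt Y y)
    (v : TangentSpace (𝓡 n) y) :
    coordDiff u y (coordConnection u Y y v) =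
      fderiv ℝ (fieldRep u Y) (u y) (coordDiff u y v) := by
  rw [coordConnection_apply hu hy hY, coordDiff_coordLift hu hy]

theorem coordConnection_coordField (hu : u ∈ coordinateSystems n M) {y : M}
    (hy : y ∈ u.source) (j : Fin n) : coordConnection u (coordField u j) y = 0 := by
  ext1 v
  rw [coordConnection_apply hu hy (fieldSmoothAt_coordField hu hy j).fieldDiffAt,
    (fieldRep_coordField_eventuallyEq hu hy j).fderiv_eq]
  simp

theorem isCovariantDerivativeOn_coordConnection (hu : u ∈ coordinateSystems n M) :
    IsCovariantDerivativeOn (I := 𝓡 n) (EuclideanSpace ℝ (Fin n)) (coordConnection u)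
      u.source where
  add {Y Y' y} hY hY' hy := by
    ext1 v
    apply coordDiff_injective hu hy
    rw [_root_.add_apply, map_add,
      coordDiff_coordConnection hu hy (mdifferentiableAt_add_section hY hY'), coordDiff_coordConnection hu hy hY,
      coordDiff_coordConnection hu hy hY']
    have : fieldRep u (Y + Y') = fieldRep u Y + fieldRep u Y' :=
      funext fun z => map_add _ _ _
    rw [this, fderiv_add ((mdifferentiableAt_field_iff hu hy).1 hY)
      ((mdifferentiableAt_field_iff hu hy).1 hY')]
    rfl
  leibniz {Y g y} hY hg hy := by
    ext1 v
    apply coordDiff_injective hu hy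
    rw [_root_.add_apply, map_add,
      coordDiff_coordConnection hu hy (hg.smul_section hY), _root_.smul_apply,
      map_smul, coordDiff_coordConnection hu hy hY, ContinuousLinearMap.smulRight_apply, map_smul,
      mvfderiv_apply_eq_fderiv hu hy hg]
    have : fieldRep u (g • Y) = (g ∘ u.symm) • fieldRep u Y :=
      funext fun z => map_smul (coordDiff u (u.symm z)) (g (u.symm z)) (Y (u.symm z))
    rw [this, fderiv_smul ((mdifferentiableAt_iff_comp_symm hu hy).1 hg)
      ((mdifferentiableAt_field_iff hu hy).1 hY), fieldRep_apply hy]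
    simp [u.left_inv hy]

/-- Fields with constant components in a trivialization are admissible test fields, and their images
under `A` are the columns of its matrix. Smoothness of ∇Y as a section of the endomorphism bundle is
thereby reduced to that of ∇_X Y for smooth X. -/
theorem contMDiffAt_hom_of_forall {A : ∀ y : M, TangentSpace (𝓡 n) y →L[ℝ] TangentSpace (𝓡 n) y}
    {y : M} (hA : ∀ X : ∀ y : M, TangentSpace (𝓡 n) y, FieldSmoothAt X y →
      FieldSmoothAt (fun z => A z (X z)) y) :
    ContMDiffAt (𝓡 n) ((𝓡 n).prod 𝓘(ℝ, EuclideanSpace ℝ (Fin n) →L[ℝ] EuclideanSpace ℝ (Fin n))) ∞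
      (fun z => (⟨z, A z⟩ : Bundle.TotalSpace
        (EuclideanSpace ℝ (Fin n) →L[ℝ] EuclideanSpace ℝ (Fin n))
        fun z => TangentSpace (𝓡 n) z →L[ℝ] TangentSpace (𝓡 n) z)) y := by
  rw [contMDiffAt_hom_bundle]
  refine ⟨contMDiffAt_id, ?_⟩
  set T := trivializationAt (EuclideanSpace ℝ (Fin n)) (TangentSpace (𝓡 n) : M → Type _) y with hT
  set Φ : M → EuclideanSpace ℝ (Fin n) →L[ℝ] EuclideanSpace ℝ (Fin n) := fun z =>
    ContinuousLinearMap.inCoordinates (EuclideanSpace ℝ (Fin n))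
      (TangentSpace (𝓡 n) : M → Type _) (EuclideanSpace ℝ (Fin n))
      (TangentSpace (𝓡 n) : M → Type _) y z y z (A z) with hΦ
  have hbase : ∀ᶠ z in 𝓝 y, z ∈ T.baseSet :=
    T.open_baseSet.mem_nhds (FiberBundle.mem_baseSet_trivializationAt' y)
  have happ : ∀ w, ContMDiffAt (𝓡 n) 𝓘(ℝ, EuclideanSpace ℝ (Fin n)) ∞ (fun z => Φ z w) y := by
    intro w
    have hX : FieldSmoothAt (fun z => T.symm z w) y := by
      refine (Bundle.contMDiffAt_section _).2 (contMDiffAt_const (c := w) |>.congr_of_eventuallyEq ?_)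
      filter_upwards [hbase] with z hz
      rw [← hT, T.apply_mk_symm hz]
    refine ((Bundle.contMDiffAt_section _).1 (hA _ hX)).congr_of_eventuallyEq ?_
    filter_upwards [hbase] with z hz
    simp only [hΦ, ContinuousLinearMap.inCoordinates, ContinuousLinearMap.comp_apply]
    refine (Bundle.Trivialization.continuousLinearMapAt_apply_of_mem ℝ T hz _).trans ?_
    exact congrArg (fun v => (T ⟨z, A z v⟩).2) (T.symmL_apply (R := ℝ) hz w)
  -- Pointwise smoothness of `Φ z w` gives smoothness in operator norm, because in finite dimension
  -- `Φ` is a finite sum of rank-one maps built from its columns.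
  have hsum : Φ = fun z => ∑ i, ContinuousLinearMap.smulRightL ℝ (EuclideanSpace ℝ (Fin n))
      (EuclideanSpace ℝ (Fin n)) (EuclideanSpace.proj i) (Φ z (EuclideanSpace.single i 1)) := by
    funext z
    ext1 w
    rw [_root_.sum_apply]
    conv_lhs => rw [← (EuclideanSpace.basisFun (Fin n) ℝ).sum_repr w, map_sum]
    refine Finset.sum_congr rfl fun i _ => ?_
    simp
  change ContMDiffAt (𝓡 n) _ ∞ Φ y
  rw [hsum]
  exact contMDiffAt_finsetSum fun i _ => (ContinuousLinearMap.contDiff _).contMDiff.contMDiffAt.comp y (happ _)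

theorem contMDiffCovariantDerivativeOn_coordConnection (hu : u ∈ coordinateSystems n M) :
    ContMDiffCovariantDerivativeOn (I := 𝓡 n) (EuclideanSpace ℝ (Fin n)) ∞ (coordConnection u)
      u.source where
  contMDiff {Y} hY := by
    intro y hy
    refine (contMDiffAt_hom_of_forall fun X hX => ?_).contMDiffWithinAt
    have hY' : ∀ z ∈ u.source, FieldSmoothAt Y z := fun z hz =>
      SmoothVectorFieldOn.fieldSmoothAt hY u.open_source hz
    rw [FieldSmoothAt, contMDiffAt_field_iff hu hy] at hX ⊢
    have : fieldRep u (fun z => coordConnection u Y z (X z)) =ᶠ[𝓝 (u y)]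
        fun z => fderiv ℝ (fieldRep u Y) z (fieldRep u X z) := by
      filter_upwards [u.open_target.mem_nhds (u.map_source hy)] with z hz
      rw [fieldRep, coordDiff_coordConnection hu (u.map_target hz)
        (hY' _ (u.map_target hz)).fieldDiffAt, u.right_inv hz]
      rfl
    refine ContDiffAt.congr_of_eventuallyEq ?_ this
    exact (((contMDiffAt_field_iff hu hy).1 (hY' y hy)).fderiv_right (m := ∞) (by simp)).clm_apply hX

theorem isLinearConnectionOn_coordConnection (hu : u ∈ coordinateSystems n M) :
    IsLinearConnectionOn (coordConnection u) u.source :=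
  ⟨isCovariantDerivativeOn_coordConnection hu, contMDiffCovariantDerivativeOn_coordConnection hu⟩

/-- In components ∇_X Y is DY(X) and ∇_Y X is DX(Y); their difference is the coordinate expression
of [X, Y]. -/
theorem isSymmetricOn_coordConnection (hu : u ∈ coordinateSystems n M) :
    IsSymmetricOn (coordConnection u) u.source := by
  intro X Y hX hY y hy
  have hX' := (hX.fieldSmoothAt u.open_source hy).fieldDiffAt
  have hY' := (hY.fieldSmoothAt u.open_source hy).fieldDiffAt
  apply coordDiff_injective hu hy
  rw [map_sub, map_sub, coordDiff_coordConnection hu hy hY', coordDiff_coordConnection hu hy hX',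
    coordDiff_mlieBracket hu hy hX' hY', sub_self, map_zero]

theorem fieldRep_coordConnection (hu : u ∈ coordinateSystems n M) {X Y : ∀ y : M, TangentSpace (𝓡 n) y}
    (hY : SmoothVectorFieldOn Y u.source) {z : EuclideanSpace ℝ (Fin n)} (hz : z ∈ u.target) :
    fieldRep u (fun y => coordConnection u Y y (X y)) z =
      fderiv ℝ (fieldRep u Y) z (fieldRep u X z) := by
  rw [fieldRep, coordDiff_coordConnection hu (u.map_target hz)
    (hY.fieldSmoothAt u.open_source (u.map_target hz)).fieldDiffAt, u.right_inv hz]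
  rfl

theorem IsLinearConnectionOn.smoothVectorFieldOn {cov : CovOp n M} {U : Set M}
    (h : IsLinearConnectionOn cov U) {X Y : ∀ y : M, TangentSpace (𝓡 n) y}
    (hX : SmoothVectorFieldOn X U) (hY : SmoothVectorFieldOn Y U) :
    SmoothVectorFieldOn (fun y => cov Y y (X y)) U := by
  have h1 := h.smooth.contMDiff (σ := Y) hY
  exact ContMDiffOn.clm_bundle_apply h1 hX

/-- The components of ∇_X ∇_Y Z are D²Z(X, Y) + DZ(DY(X)). The second-order terms cancel by
symmetry, and the first-order ones form DZ([X, Y]). -/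
theorem isFlatOn_coordConnection (hu : u ∈ coordinateSystems n M) :
    IsFlatOn (coordConnection u) u.source := by
  intro X Y Z hX hY hZ y hy
  have hcov := isLinearConnectionOn_coordConnection hu
  have hX' := (hX.fieldSmoothAt u.open_source hy)
  have hY' := (hY.fieldSmoothAt u.open_source hy)
  have hZ' := (hZ.fieldSmoothAt u.open_source hy)
  have hYZ := ((hcov.smoothVectorFieldOn hY hZ).fieldSmoothAt u.open_source hy)
  have hXZ := ((hcov.smoothVectorFieldOn hX hZ).fieldSmoothAt u.open_source hy)
  have ev : ∀ W, fieldRep u (fun y => coordConnection u Z y (W y)) =ᶠ[𝓝 (u y)]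
      fun z => fderiv ℝ (fieldRep u Z) z (fieldRep u W z) := fun W => by
    filter_upwards [u.open_target.mem_nhds (u.map_source hy)] with z hz
    exact fieldRep_coordConnection hu hZ hz
  have hZr := (contMDiffAt_field_iff hu hy).1 hZ'
  have hdZ : DifferentiableAt ℝ (fderiv ℝ (fieldRep u Z)) (u y) :=
    (hZr.fderiv_right (m := 1) (by rw [one_add_one_eq_two]; exact two_le_infty)).differentiableAt one_ne_zero
  apply coordDiff_injective hu hy
  rw [map_sub, map_sub, coordDiff_coordConnection hu hy hYZ.fieldDiffAt,
    coordDiff_coordConnection hu hy hXZ.fieldDiffAt, coordDiff_coordConnection hu hy hZ'.fieldDiffAt,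
    coordDiff_mlieBracket hu hy hX'.fieldDiffAt hY'.fieldDiffAt, (ev Y).fderiv_eq, (ev X).fderiv_eq,
    fderiv_clm_apply hdZ ((mdifferentiableAt_field_iff hu hy).1 hY'.fieldDiffAt),
    fderiv_clm_apply hdZ ((mdifferentiableAt_field_iff hu hy).1 hX'.fieldDiffAt)]
  have hsymm : IsSymmSndFDerivAt ℝ (fieldRep u Z) (u y) :=
    hZr.isSymmSndFDerivAt (by simpa using two_le_infty)
  simp only [_root_.add_apply, ContinuousLinearMap.comp_apply,
    ContinuousLinearMap.flip_apply, map_sub, map_zero, fieldRep_apply hy]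
  rw [hsymm.eq]
  abel

/-- A covariant derivative is determined by its values on a coordinate frame. -/
theorem IsCovariantDerivativeOn.eq_sum_coordField (hu : u ∈ coordinateSystems n M) {y : M}
    (hy : y ∈ u.source) {cov : CovOp n M} {s : Set M} (hs : s ∈ 𝓝 y)
    (hcov : IsCovariantDerivativeOn (I := 𝓡 n) (EuclideanSpace ℝ (Fin n)) cov s)
    {Y : ∀ y : M, TangentSpace (𝓡 n) y} (hY : FieldDiffAt Y y) :
    cov Y y = ∑ i, (coordForm u i y (Y y) • cov (coordField u i) y +
      (mvfderiv (𝓡 n) (fun z => coordForm u i z (Y z)) y).smulRight (coordField u i y)) := by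
  have hf := fun i => mdifferentiableAt_coordForm_apply hu hy hY i
  have he := fun i => (fieldSmoothAt_coordField hu hy i).fieldDiffAt
  have hfe : ∀ i, FieldDiffAt ((fun z => coordForm u i z (Y z)) • coordField u i) y :=
    fun i => (hf i).smul_section (he i)
  -- Additivity of `cov` holds only for differentiable fields, so the induction carries
  -- differentiability of the partial sums along with the formula.
  have hsum : ∀ t : Finset (Fin n),
      FieldDiffAt (∑ i ∈ t, (fun z => coordForm u i z (Y z)) • coordField u i) y ∧
      cov (∑ i ∈ t, (fun z => coordForm u i z (Y z)) • coordField u i) y =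
        ∑ i ∈ t, (coordForm u i y (Y y) • cov (coordField u i) y +
      (mvfderiv (𝓡 n) (fun z => coordForm u i z (Y z)) y).smulRight (coordField u i y)) := by
    intro t
    induction t using Finset.induction_on with
    | empty =>
      simp only [Finset.sum_empty]
      exact ⟨Bundle.mdifferentiableAt_zeroSection _ _, hcov.zero (mem_of_mem_nhds hs)⟩
    | insert i t hi ih =>
      rw [Finset.sum_insert hi, Finset.sum_insert hi]
      refine ⟨mdifferentiableAt_add_section (hfe i) ih.1, ?_⟩
      rw [hcov.add (hfe i) ih.1 (mem_of_mem_nhds hs), ih.2,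
        hcov.leibniz (he i) (hf i) (mem_of_mem_nhds hs)]
  have hev : ∀ᶠ z in 𝓝 y, Y z =
      (∑ i, (fun z => coordForm u i z (Y z)) • coordField u i) z := by
    filter_upwards [u.open_source.mem_nhds hy] with z hz
    rw [Finset.sum_apply]
    exact (sum_coordForm_smul_coordField hu hz (Y z)).symm
  rw [hcov.congr_of_eventuallyEq hY (hsum _).1 hs hev, (hsum _).2]

theorem IsCovariantDerivativeOn.eq_of_coordField (hu : u ∈ coordinateSystems n M) {y : M}
    (hy : y ∈ u.source) {cov cov' : CovOp n M} {s s' : Set M} (hs : s ∈ 𝓝 y) (hs' : s' ∈ 𝓝 y)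
    (hcov : IsCovariantDerivativeOn (I := 𝓡 n) (EuclideanSpace ℝ (Fin n)) cov s)
    (hcov' : IsCovariantDerivativeOn (I := 𝓡 n) (EuclideanSpace ℝ (Fin n)) cov' s')
    (h : ∀ i, cov (coordField u i) y = cov' (coordField u i) y)
    {Y : ∀ y : M, TangentSpace (𝓡 n) y} (hY : FieldDiffAt Y y) : cov Y y = cov' Y y := by
  rw [eq_sum_coordField hu hy hs hcov hY, eq_sum_coordField hu hy hs' hcov' hY]
  simp_rw [h]

theorem ext_coordField (hu : u ∈ coordinateSystems n M) {y : M} (hy : y ∈ u.source)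
    {F : Type*} [AddCommGroup F] [Module ℝ F] [TopologicalSpace F]
    {A B : TangentSpace (𝓡 n) y →L[ℝ] F}
    (h : ∀ i, A (coordField u i y) = B (coordField u i y)) : A = B := by
  ext1 v
  rw [← sum_coordForm_smul_coordField hu hy v]
  simp only [map_sum, map_smul, h]

end
end ConstCoeff

/-! ### Alternating maps and tensors in coordinates -/

namespace ConstCoeff
open Filter Topology Set

section MultilinearAlgebra

variable {N : Type*} [NormedAddCommGroup N] [NormedSpace ℝ N] {p : ℕ}

/-- Alternating maps are determined by their values on the increasing tuples of basis vectors. -/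
theorem _root_.AlternatingMap.ext_orderEmbedding {n : ℕ} (b : Module.Basis (Fin n) ℝ N)
    {f g : N [⋀^Fin p]→ₗ[ℝ] ℝ}
    (h : ∀ I : Fin p ↪o Fin n, f (fun k => b (I k)) = g (fun k => b (I k))) : f = g := by
  refine b.ext_alternating fun v hv => ?_
  -- An injective tuple of indices becomes strictly increasing after sorting, and sorting multiplies
  -- both alternating maps by the same sign.
  have hmono : StrictMono (v ∘ Tuple.sort v) :=
    (Tuple.monotone_sort v).strictMono_of_injective (hv.comp (Tuple.sort v).injective)
  have h1 := f.map_perm (fun i => b (v i)) (Tuple.sort v)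
  have h2 := g.map_perm (fun i => b (v i)) (Tuple.sort v)
  have h3 := h (OrderEmbedding.ofStrictMono _ hmono)
  have h4 : f ((fun i => b (v i)) ∘ Tuple.sort v) = g ((fun i => b (v i)) ∘ Tuple.sort v) := h3
  rw [h1, h2] at h4
  exact smul_left_cancel _ h4

/-- Expanding every argument in the basis gives a polynomial in continuous coordinates. Continuity
is what makes the differential calculus of multilinear maps applicable to tensors given only
algebraically. -/
theorem _root_.MultilinearMap.continuous_of_basis {ι : Type*} [Fintype ι]
    (b : Module.Basis ι ℝ N) (f : MultilinearMap ℝ (fun _ : Fin p => N) ℝ) : Continuous f := by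
  classical
  have := Module.Basis.finiteDimensional_of_finite b
  have h : ∀ m, f m = ∑ r : Fin p → ι, (∏ k, b.coord (r k) (m k)) * f (fun k => b (r k)) := by
    intro m
    have hm : m = fun k => ∑ j, b.repr (m k) j • b j := funext fun k => (b.sum_repr (m k)).symm
    conv_lhs => rw [hm, f.map_sum]
    exact Finset.sum_congr rfl fun r _ => f.map_smul_univ _ _
  rw [show (f : (Fin p → N) → ℝ) = _ from funext h]
  refine continuous_finsetSum _ fun r _ => Continuous.mul (continuous_finsetProd _ fun k _ => ?_)
    continuous_const
  exact (LinearMap.continuous_of_finiteDimensional (b.coord (r k))).comp (continuous_apply k)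

/-- The product rule for a multilinear map. -/
theorem _root_.MultilinearMap.hasFDerivAt_comp_of_basis {ι : Type*} [Fintype ι]
    (b : Module.Basis ι ℝ N) (f : MultilinearMap ℝ (fun _ : Fin p => N) ℝ)
    {E : Type*} [NormedAddCommGroup E] [NormedSpace ℝ E] {g : Fin p → E → N} {x : E}
    (hg : ∀ k, DifferentiableAt ℝ (g k) x) :
    DifferentiableAt ℝ (fun z => f (fun k => g k z)) x ∧
    ∀ v, fderiv ℝ (fun z => f (fun k => g k z)) x v =
      ∑ k, f (Function.update (fun l => g l x) k (fderiv ℝ (g k) x v)) := by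
  let F : ContinuousMultilinearMap ℝ (fun _ : Fin p => N) ℝ := ⟨f, f.continuous_of_basis b⟩
  have h := (F.hasFDerivAt (fun l => g l x)).comp x (hasFDerivAt_pi.2 fun k => (hg k).hasFDerivAt)
  have h' : HasFDerivAt (fun z => f (fun k => g k z)) _ x := h
  refine ⟨h'.differentiableAt, fun v => ?_⟩
  rw [h'.fderiv, ContinuousLinearMap.comp_apply, ContinuousMultilinearMap.linearDeriv_apply]
  rfl

variable (n : ℕ) in
/-- The basis of coordinate functions of the dual of the Euclidean space. -/
def projBasis : Module.Basis (Fin n) ℝ (EuclideanSpace ℝ (Fin n) →L[ℝ] ℝ) :=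
  (EuclideanSpace.basisFun (Fin n) ℝ).toBasis.dualBasis.map LinearMap.toContinuousLinearMap

theorem projBasis_apply {n : ℕ} (i : Fin n) : projBasis n i = EuclideanSpace.proj i := by
  ext v
  simp [projBasis]

end MultilinearAlgebra

variable {n : ℕ} {M : Type*} [TopologicalSpace M] [ChartedSpace (EuclideanSpace ℝ (Fin n)) M]
variable {u : OpenPartialHomeomorph M (EuclideanSpace ℝ (Fin n))}

/-- A multivector, as an alternating map on the covectors in coordinates. -/
def multiRep {q : ℕ} (u : OpenPartialHomeomorph M (EuclideanSpace ℝ (Fin n)))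
    (V : ∀ y : M, ⋀[ℝ]^q (TangentSpace (𝓡 n) y)) (z : EuclideanSpace ℝ (Fin n)) :
    (EuclideanSpace ℝ (Fin n) →L[ℝ] ℝ) [⋀^Fin q]→ₗ[ℝ] ℝ :=
  (((LinearMap.applyₗ (V (u.symm z))).compAlternatingMap
    (exteriorPower.alternatingMapToDual ℝ (TangentSpace (𝓡 n) (u.symm z)) q)).compLinearMap
      (LinearMap.dualMap (coordDiff u (u.symm z) : TangentSpace (𝓡 n) (u.symm z) →ₗ[ℝ]
        EuclideanSpace ℝ (Fin n)))).compLinearMap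
    (ContinuousLinearMap.coeLM ℝ)

theorem multiRep_apply {q : ℕ} (V : ∀ y : M, ⋀[ℝ]^q (TangentSpace (𝓡 n) y))
    (z : EuclideanSpace ℝ (Fin n)) (β : Fin q → EuclideanSpace ℝ (Fin n) →L[ℝ] ℝ) :
    multiRep u V z β = multivectorEval (V (u.symm z))
      (fun k => (β k).comp (coordDiff u (u.symm z))) := by
  rw [multivectorEval, exteriorPower.pairingDual, exteriorPower.alternatingMapLinearEquiv_apply_ιMulti]
  rfl

/-- A form in coordinates. -/
def formRep {p : ℕ} (u : OpenPartialHomeomorph M (EuclideanSpace ℝ (Fin n)))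
    (η : ∀ y : M, (TangentSpace (𝓡 n) y) [⋀^Fin p]→L[ℝ] ℝ) (z : EuclideanSpace ℝ (Fin n)) :
    EuclideanSpace ℝ (Fin n) [⋀^Fin p]→ₗ[ℝ] ℝ :=
  (η (u.symm z)).toAlternatingMap.compLinearMap (coordLift u (u.symm z) :
    EuclideanSpace ℝ (Fin n) →ₗ[ℝ] TangentSpace (𝓡 n) (u.symm z))

theorem formRep_apply {p : ℕ} (η : ∀ y : M, (TangentSpace (𝓡 n) y) [⋀^Fin p]→L[ℝ] ℝ)
    (z : EuclideanSpace ℝ (Fin n)) (w : Fin p → EuclideanSpace ℝ (Fin n)) :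
    formRep u η z w = η (u.symm z) (fun k => coordLift u (u.symm z) (w k)) := rfl

/-- A 1-form in coordinates. -/
def oneFormRep (u : OpenPartialHomeomorph M (EuclideanSpace ℝ (Fin n)))
    (α : ∀ y : M, TangentSpace (𝓡 n) y →L[ℝ] ℝ) (z : EuclideanSpace ℝ (Fin n)) :
    EuclideanSpace ℝ (Fin n) →L[ℝ] ℝ :=
  (α (u.symm z)).comp (coordLift u (u.symm z))

end ConstCoeff

namespace ConstCoeff
open Filter Topology Set

variable {n : ℕ} {M : Type*} [TopologicalSpace M] [ChartedSpace (EuclideanSpace ℝ (Fin n)) M]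
variable {u : OpenPartialHomeomorph M (EuclideanSpace ℝ (Fin n))}
section
variable [IsManifold (𝓡 n) ∞ M]

/-! ### Covariant derivatives of 1-forms -/

/-- The 1-form `α` is differentiable at `y`. -/
def OneFormDiffAt (α : ∀ y : M, TangentSpace (𝓡 n) y →L[ℝ] ℝ) (y : M) : Prop :=
  ∀ Y : ∀ y : M, TangentSpace (𝓡 n) y, FieldDiffAt Y y →
    MDifferentiableAt (𝓡 n) 𝓘(ℝ, ℝ) (fun z => α z (Y z)) y

theorem eventuallyEq_sum_coordField (hu : u ∈ coordinateSystems n M) {y : M} (hy : y ∈ u.source)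
    (α : ∀ y : M, TangentSpace (𝓡 n) y →L[ℝ] ℝ) (Y : ∀ y : M, TangentSpace (𝓡 n) y) :
    (fun z => α z (Y z)) =ᶠ[𝓝 y]
      fun z => ∑ i, coordForm u i z (Y z) * α z (coordField u i z) := by
  filter_upwards [u.open_source.mem_nhds hy] with z hz
  conv_lhs => rw [← sum_coordForm_smul_coordField hu hz (Y z)]
  rw [map_sum]
  exact Finset.sum_congr rfl fun i _ => map_smul _ _ _

/-- Near `y`, α(Y) = ∑ Yⁱ α(∂/∂uⁱ), a sum of products of differentiable functions. -/
theorem oneFormDiffAt_of_coordField (hu : u ∈ coordinateSystems n M) {y : M} (hy : y ∈ u.source)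
    {α : ∀ y : M, TangentSpace (𝓡 n) y →L[ℝ] ℝ}
    (h : ∀ i, MDifferentiableAt (𝓡 n) 𝓘(ℝ, ℝ) (fun z => α z (coordField u i z)) y) :
    OneFormDiffAt α y := by
  intro Y hY
  refine MDifferentiableAt.congr_of_eventuallyEq ?_ (eventuallyEq_sum_coordField hu hy α Y)
  rw [mdifferentiableAt_iff_comp_symm hu hy]
  have h1 := fun i => (mdifferentiableAt_iff_comp_symm hu hy).1
    (mdifferentiableAt_coordForm_apply hu hy hY i)
  have h2 := fun i => (mdifferentiableAt_iff_comp_symm hu hy).1 (h i)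
  exact DifferentiableAt.fun_sum fun i _ => (h1 i).mul (h2 i)

theorem SmoothOneFormOn.oneFormDiffAt {α : ∀ y : M, TangentSpace (𝓡 n) y →L[ℝ] ℝ} {U : Set M}
    (h : SmoothOneFormOn α U) (hU : IsOpen U) {y : M} (hy : y ∈ U) : OneFormDiffAt α y := by
  set e := chartAt (EuclideanSpace ℝ (Fin n)) y
  have he : e ∈ coordinateSystems n M := IsManifold.chart_mem_maximalAtlas y
  have hye : y ∈ e.source := mem_chart_source _ y
  refine oneFormDiffAt_of_coordField he hye fun i => ?_
  exact ((h e he i).contMDiffAt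
    ((e.open_source.inter hU).mem_nhds ⟨hye, hy⟩)).mdifferentiableAt (by simp)

theorem mvfderiv_oneForm_apply (hu : u ∈ coordinateSystems n M) {y : M} (hy : y ∈ u.source)
    {α : ∀ y : M, TangentSpace (𝓡 n) y →L[ℝ] ℝ} (hα : OneFormDiffAt α y)
    {Y : ∀ y : M, TangentSpace (𝓡 n) y} (hY : FieldDiffAt Y y) (v : TangentSpace (𝓡 n) y) :
    mvfderiv (𝓡 n) (fun z => α z (Y z)) y v =
      ∑ i, (coordForm u i y (Y y) * mvfderiv (𝓡 n) (fun z => α z (coordField u i z)) y v +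
        mvfderiv (𝓡 n) (fun z => coordForm u i z (Y z)) y v * α y (coordField u i y)) := by
  have hc := fun i => hα _ (fieldSmoothAt_coordField hu hy i).fieldDiffAt
  have hd := fun i => mdifferentiableAt_coordForm_apply hu hy hY i
  have h1 := fun i => (mdifferentiableAt_iff_comp_symm hu hy).1 (hd i)
  have h2 := fun i => (mdifferentiableAt_iff_comp_symm hu hy).1 (hc i)
  rw [mvfderiv_apply_eq_fderiv hu hy (hα Y hY)]
  have hev : (fun z => α z (Y z)) ∘ u.symm =ᶠ[𝓝 (u y)] fun z => ∑ i,
      ((fun z => coordForm u i z (Y z)) ∘ u.symm) z *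
        ((fun z => α z (coordField u i z)) ∘ u.symm) z := by
    have ht : Tendsto u.symm (𝓝 (u y)) (𝓝 y) := u.tendsto_symm hy
    exact ht.eventually (eventuallyEq_sum_coordField hu hy α Y)
  rw [hev.fderiv_eq, fderiv_fun_sum fun i _ => (h1 i).fun_mul (h2 i), _root_.sum_apply]
  refine Finset.sum_congr rfl fun i _ => ?_
  rw [fderiv_fun_mul (h1 i) (h2 i), mvfderiv_apply_eq_fderiv hu hy (hc i),
    mvfderiv_apply_eq_fderiv hu hy (hd i)]
  have hc' : ∀ f : M → ℝ, (f ∘ u.symm) (u y) = f y := fun f => congrArg f (u.left_inv hy)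
  simp only [_root_.add_apply, _root_.smul_apply, smul_eq_mul, hc']
  ring

/-- The Leibniz rule defining the covariant derivative of a 1-form. -/
theorem covDerivOneForm_apply {cov : CovOp n M} {y : M} {s : Set M} (hs : s ∈ 𝓝 y)
    (hcov : IsCovariantDerivativeOn (I := 𝓡 n) (EuclideanSpace ℝ (Fin n)) cov s)
    {α : ∀ y : M, TangentSpace (𝓡 n) y →L[ℝ] ℝ} (hα : OneFormDiffAt α y)
    (X : ∀ y : M, TangentSpace (𝓡 n) y)
    {Y : ∀ y : M, TangentSpace (𝓡 n) y} (hY : FieldDiffAt Y y) :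
    covDerivOneForm cov α X y (Y y) =
      mvfderiv (𝓡 n) (fun z => α z (Y z)) y (X y) - α y (cov Y y (X y)) := by
  have he : chartAt (EuclideanSpace ℝ (Fin n)) y ∈ coordinateSystems n M :=
    IsManifold.chart_mem_maximalAtlas y
  have hye : y ∈ (chartAt (EuclideanSpace ℝ (Fin n)) y).source := mem_chart_source _ y
  -- Expand Y in the frame ∂ᵢ of the preferred chart at `y`: the terms X(Yⁱ) α(∂ᵢ) occur in both
  -- X(α(Y)) and α(∇_X Y) and cancel, leaving the defining sum of ∇_X α.
  rw [mvfderiv_oneForm_apply he hye hα hY, IsCovariantDerivativeOn.eq_sum_coordField he hye hs hcov hY,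
    covDerivOneForm, _root_.sum_apply, _root_.sum_apply, map_sum, ← Finset.sum_sub_distrib]
  refine Finset.sum_congr rfl fun i _ => ?_
  rw [_root_.smul_apply, _root_.add_apply, _root_.smul_apply, ContinuousLinearMap.smulRight_apply,
    map_add, map_smul, map_smul]
  simp only [smul_eq_mul]
  ring

theorem covDerivOneForm_coordConnection_coordField (hu : u ∈ coordinateSystems n M) {y : M}
    (hy : y ∈ u.source) {α : ∀ y : M, TangentSpace (𝓡 n) y →L[ℝ] ℝ} (hα : OneFormDiffAt α y)
    (X : ∀ y : M, TangentSpace (𝓡 n) y) (i : Fin n) :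
    covDerivOneForm (coordConnection u) α X y (coordField u i y) =
      mvfderiv (𝓡 n) (fun z => α z (coordField u i z)) y (X y) := by
  rw [covDerivOneForm_apply (u.open_source.mem_nhds hy) (isCovariantDerivativeOn_coordConnection hu)
    hα X (fieldSmoothAt_coordField hu hy i).fieldDiffAt, coordConnection_coordField hu hy]
  simp

theorem oneFormDiffAt_coordForm (hu : u ∈ coordinateSystems n M) {y : M} (hy : y ∈ u.source)
    (i : Fin n) : OneFormDiffAt (coordForm u i) y :=
  fun _ hY => mdifferentiableAt_coordForm_apply hu hy hY i

theorem smoothOneFormOn_coordForm (hu : u ∈ coordinateSystems n M) (i : Fin n) :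
    SmoothOneFormOn (coordForm u i) u.source := by
  intro e he j y hy
  refine ContMDiffAt.contMDiffWithinAt ?_
  rw [contMDiffAt_iff_comp_symm hu hy.2]
  refine ContDiffAt.congr_of_eventuallyEq ?_ (coordForm_comp_symm_eventuallyEq hu hy.2 _ i)
  exact (EuclideanSpace.proj i : EuclideanSpace ℝ (Fin n) →L[ℝ] ℝ).contDiff.contDiffAt.comp _
    ((contMDiffAt_field_iff hu hy.2).1 (fieldSmoothAt_coordField he hy.1 j))

theorem covDerivOneForm_coordConnection_coordForm (hu : u ∈ coordinateSystems n M) {y : M}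
    (hy : y ∈ u.source) (X : ∀ y : M, TangentSpace (𝓡 n) y) (i : Fin n) :
    covDerivOneForm (coordConnection u) (coordForm u i) X y = 0 := by
  refine ext_coordField hu hy fun j => ?_
  rw [covDerivOneForm_coordConnection_coordField hu hy (oneFormDiffAt_coordForm hu hy i),
    mvfderiv_coordForm_apply hu hy (fieldSmoothAt_coordField hu hy j).fieldDiffAt,
    (fieldRep_coordField_eventuallyEq hu hy j).fderiv_eq]
  simp

theorem oneFormRep_eq_sum (u : OpenPartialHomeomorph M (EuclideanSpace ℝ (Fin n)))
    (α : ∀ y : M, TangentSpace (𝓡 n) y →L[ℝ] ℝ)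
    (z : EuclideanSpace ℝ (Fin n)) : oneFormRep u α z =
      ∑ i, α (u.symm z) (coordField u i (u.symm z)) •
        (EuclideanSpace.proj i : EuclideanSpace ℝ (Fin n) →L[ℝ] ℝ) := by
  ext1 v
  rw [oneFormRep, ContinuousLinearMap.comp_apply, ← sum_smul_coordField, map_sum, _root_.sum_apply]
  refine Finset.sum_congr rfl fun i _ => ?_
  rw [map_smul, _root_.smul_apply, smul_eq_mul, smul_eq_mul, mul_comm]
  rfl

theorem differentiableAt_oneFormRep (hu : u ∈ coordinateSystems n M) {y : M} (hy : y ∈ u.source)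
    {α : ∀ y : M, TangentSpace (𝓡 n) y →L[ℝ] ℝ} (hα : OneFormDiffAt α y) :
    DifferentiableAt ℝ (oneFormRep u α) (u y) := by
  rw [show oneFormRep u α = _ from funext (oneFormRep_eq_sum u α)]
  refine DifferentiableAt.fun_sum fun i _ => DifferentiableAt.smul_const ?_ _
  exact (mdifferentiableAt_iff_comp_symm hu hy).1
    (hα _ (fieldSmoothAt_coordField hu hy i).fieldDiffAt)

/-- Against the parallel frame ∂/∂uⁱ the Leibniz rule has no correction term, so ∇^u differentiates
the components of α. -/
theorem covDerivOneForm_coordConnection (hu : u ∈ coordinateSystems n M) {y : M}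
    (hy : y ∈ u.source) {α : ∀ y : M, TangentSpace (𝓡 n) y →L[ℝ] ℝ} (hα : OneFormDiffAt α y)
    (X : ∀ y : M, TangentSpace (𝓡 n) y) :
    covDerivOneForm (coordConnection u) α X y =
      (fderiv ℝ (oneFormRep u α) (u y) (coordDiff u y (X y))).comp (coordDiff u y) := by
  refine ext_coordField hu hy fun i => ?_
  have hd := hα _ (fieldSmoothAt_coordField hu hy i).fieldDiffAt
  rw [covDerivOneForm_coordConnection_coordField hu hy hα, ContinuousLinearMap.comp_apply,
    coordDiff_coordField hu hy, mvfderiv_apply_eq_fderiv hu hy hd]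
  have h := (ContinuousLinearMap.apply ℝ ℝ (EuclideanSpace.single i (1 : ℝ))).hasFDerivAt.comp (u y)
    (differentiableAt_oneFormRep hu hy hα).hasFDerivAt
  exact congrArg (fun L => L (coordDiff u y (X y))) h.fderiv

/-! ### Functions with vanishing derivatives -/

/-- Read in `u`, the function has zero derivative on the target of `u`, which is open and inherits
connectedness from the source. -/
theorem exists_const_of_mvfderiv_coordField (hu : u ∈ coordinateSystems n M)
    (hconn : IsPreconnected u.source) {f : M → ℝ}
    (hf : ContMDiffOn (𝓡 n) 𝓘(ℝ, ℝ) ∞ f u.source)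
    (h : ∀ y ∈ u.source, ∀ j, mvfderiv (𝓡 n) f y (coordField u j y) = 0) :
    ∃ c, ∀ y ∈ u.source, f y = c := by
  have hd : ∀ z ∈ u.target, DifferentiableAt ℝ (f ∘ u.symm) z := fun z hz => by
    have hy := u.map_target hz
    have h1 := (mdifferentiableAt_iff_comp_symm hu hy).1
      ((hf.contMDiffAt (u.open_source.mem_nhds hy)).mdifferentiableAt (by simp))
    rwa [u.right_inv hz] at h1
  have hz : u.target.EqOn (fderiv ℝ (f ∘ u.symm)) 0 := fun z hz => by
    have hy := u.map_target hz
    have h1 : mvfderiv (𝓡 n) f (u.symm z) = 0 :=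
      ext_coordField hu hy fun j => by simpa using h _ hy j
    ext1 v
    have h2 := mvfderiv_apply_eq_fderiv hu hy
      ((hf.contMDiffAt (u.open_source.mem_nhds hy)).mdifferentiableAt (by simp))
      (coordLift u (u.symm z) v)
    rw [coordDiff_coordLift hu hy, h1, u.right_inv hz] at h2
    exact h2.symm
  have hconn' : IsPreconnected u.target := by
    rw [← u.image_source_eq_target]
    exact hconn.image _ u.continuousOn
  obtain ⟨c, hc⟩ := u.open_target.exists_is_const_of_fderiv_eq_zero hconn'
    (fun z hz => (hd z hz).differentiableWithinAt) hz
  refine ⟨c, fun y hy => ?_⟩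
  have := hc _ (u.map_source hy)
  rwa [Function.comp_apply, u.left_inv hy] at this

/-! ### Constant coefficients and parallelism -/

/-- Constancy on increasing index tuples makes the whole alternating map independent of the point in
coordinates. The product rule for this fixed map then produces precisely the correction terms of ∇^u
η. -/
theorem DiffForm.ConstCoeffsIn.parallelOn (hu : u ∈ coordinateSystems n M) {p : ℕ}
    {η : DiffForm n M p} (h : η.ConstCoeffsIn u) : η.ParallelOn (coordConnection u) u.source := by
  intro X Y hX hY y hy
  have hconst : ∀ z ∈ u.target, formRep u η.toFun z = formRep u η.toFun (u y) := fun z hz => by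
    refine AlternatingMap.ext_orderEmbedding (EuclideanSpace.basisFun (Fin n) ℝ).toBasis
      fun I => ?_
    obtain ⟨c, hc⟩ := h I
    have h1 := hc _ (u.map_target hz)
    have h2 := hc _ (u.map_target (u.map_source hy))
    simp only [formRep_apply, OrthonormalBasis.coe_toBasis, EuclideanSpace.basisFun_apply]
    exact h1.trans h2.symm
  have hdY := fun k => ((hY k).fieldSmoothAt u.open_source hy).fieldDiffAt
  obtain ⟨h1, h2⟩ := (formRep u η.toFun (u y)).toMultilinearMap.hasFDerivAt_comp_of_basis
    (EuclideanSpace.basisFun (Fin n) ℝ).toBasis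
    (fun k => (mdifferentiableAt_field_iff hu hy).1 (hdY k))
  have hev : (fun z => η.toFun z (fun k => Y k z)) ∘ u.symm =ᶠ[𝓝 (u y)] fun z =>
      (formRep u η.toFun (u y)).toMultilinearMap (fun k => fieldRep u (Y k) z) := by
    filter_upwards [u.open_target.mem_nhds (u.map_source hy)] with z hz
    rw [← hconst z hz]
    refine (congrArg (η.toFun (u.symm z)) (funext fun k => ?_)).symm
    exact coordLift_coordDiff hu (u.map_target hz) _
  rw [covDerivForm, mvfderiv_apply_eq_fderiv hu hy ((mdifferentiableAt_iff_comp_symm hu hy).2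
    (h1.congr_of_eventuallyEq hev)), hev.fderiv_eq, h2, ← Finset.sum_sub_distrib]
  refine Finset.sum_eq_zero fun k _ => sub_eq_zero.2 ?_
  rw [AlternatingMap.coe_multilinearMap, formRep_apply, u.left_inv hy]
  congr 1
  funext l
  rcases eq_or_ne l k with rfl | hl
  · rw [Function.update_self, Function.update_self, coordConnection_apply hu hy (hdY l)]
  · rw [Function.update_of_ne hl, Function.update_of_ne hl, fieldRep_apply hy,
      coordLift_coordDiff hu hy]

/-- Testing on coordinate fields kills all correction terms, so every derivative of every
coefficient vanishes. -/
theorem DiffForm.ParallelOn.constCoeffsIn (hu : u ∈ coordinateSystems n M)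
    (hconn : IsPreconnected u.source) {p : ℕ} {η : DiffForm n M p}
    (h : η.ParallelOn (coordConnection u) u.source) : η.ConstCoeffsIn u := by
  intro I
  refine exists_const_of_mvfderiv_coordField hu hconn (η.smooth u hu I) fun y hy j => ?_
  have h1 := h (coordField u j) (fun k => coordField u (I k)) (smoothVectorFieldOn_coordField hu j)
    (fun k => smoothVectorFieldOn_coordField hu (I k)) y hy
  rw [covDerivForm, Finset.sum_eq_zero, sub_zero] at h1
  · exact h1
  · intro k _
    refine (η.toFun y).map_coord_zero k ?_
    rw [Function.update_self, coordConnection_coordField hu hy]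
    rfl

/-- Same mechanism as for forms, with the multivector regarded as an alternating map on covectors
and ∇^u acting on 1-forms by differentiation of components. -/
theorem MultivectorField.ConstCoeffsIn.parallelOn (hu : u ∈ coordinateSystems n M) {q : ℕ}
    {V : MultivectorField n M q} (h : V.ConstCoeffsIn u) :
    V.ParallelOn (coordConnection u) u.source := by
  intro X α hX hα y hy
  have hconst : ∀ z ∈ u.target, multiRep u V.toFun z = multiRep u V.toFun (u y) := fun z hz => by
    refine AlternatingMap.ext_orderEmbedding (projBasis n) fun I => ?_
    obtain ⟨c, hc⟩ := h I
    have h1 := hc _ (u.map_target hz)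
    have h2 := hc _ (u.map_target (u.map_source hy))
    simp only [multiRep_apply, projBasis_apply, ← coordForm_eq hu (u.map_target hz),
      ← coordForm_eq hu (u.map_target (u.map_source hy))]
    exact h1.trans h2.symm
  have hdα := fun k => (hα k).oneFormDiffAt u.open_source hy
  obtain ⟨h1, h2⟩ := (multiRep u V.toFun (u y)).toMultilinearMap.hasFDerivAt_comp_of_basis
    (projBasis n) (fun k => differentiableAt_oneFormRep hu hy (hdα k))
  have hcomp : ∀ k, ∀ z ∈ u.source,
      ((α k z).comp (coordLift u z)).comp (coordDiff u z) = α k z := fun k z hz =>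
    ContinuousLinearMap.ext fun v => congrArg (α k z) (coordLift_coordDiff hu hz v)
  have hev : (fun z => multivectorEval (V.toFun z) (fun k => α k z)) ∘ u.symm =ᶠ[𝓝 (u y)] fun z =>
      (multiRep u V.toFun (u y)).toMultilinearMap (fun k => oneFormRep u (α k) z) := by
    filter_upwards [u.open_target.mem_nhds (u.map_source hy)] with z hz
    rw [← hconst z hz, AlternatingMap.coe_multilinearMap, multiRep_apply]
    refine (congrArg (multivectorEval (V.toFun (u.symm z))) (funext fun k => ?_)).symm
    exact hcomp k _ (u.map_target hz)
  rw [covDerivMultivector, mvfderiv_apply_eq_fderiv hu hy ((mdifferentiableAt_iff_comp_symm hu hy).2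
    (h1.congr_of_eventuallyEq hev)), hev.fderiv_eq, h2, ← Finset.sum_sub_distrib]
  refine Finset.sum_eq_zero fun k _ => sub_eq_zero.2 ?_
  rw [AlternatingMap.coe_multilinearMap, multiRep_apply, u.left_inv hy]
  congr 1
  funext l
  rcases eq_or_ne l k with rfl | hl
  · rw [Function.update_self, Function.update_self, covDerivOneForm_coordConnection hu hy (hdα l)]
  · rw [Function.update_of_ne hl, Function.update_of_ne hl, oneFormRep, u.left_inv hy,
      hcomp l y hy]

theorem multivectorEval_eq_zero {q : ℕ} {y : M} (W : ⋀[ℝ]^q (TangentSpace (𝓡 n) y))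
    {α : Fin q → (TangentSpace (𝓡 n) y →L[ℝ] ℝ)} (k : Fin q) (h : α k = 0) :
    multivectorEval W α = 0 := by
  rw [multivectorEval, AlternatingMap.map_coord_zero _ k (by rw [h]; rfl), map_zero]
  rfl

/-- The test objects are the 1-forms duⁱ, which are parallel for ∇^u. -/
theorem MultivectorField.ParallelOn.constCoeffsIn (hu : u ∈ coordinateSystems n M)
    (hconn : IsPreconnected u.source) {q : ℕ} {V : MultivectorField n M q}
    (h : V.ParallelOn (coordConnection u) u.source) : V.ConstCoeffsIn u := by
  intro I
  refine exists_const_of_mvfderiv_coordField hu hconn (V.smooth u hu I) fun y hy j => ?_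
  have h1 := h (coordField u j) (fun k => coordForm u (I k)) (smoothVectorFieldOn_coordField hu j)
    (fun k => smoothOneFormOn_coordForm hu (I k)) y hy
  rw [covDerivMultivector, Finset.sum_eq_zero, sub_zero] at h1
  · exact h1
  · intro k _
    refine multivectorEval_eq_zero _ k ?_
    rw [Function.update_self, covDerivOneForm_coordConnection_coordForm hu hy]

end
end ConstCoeff

namespace ConstCoeff
open Filter Topology Set

variable {n : ℕ} {M : Type*} [TopologicalSpace M] [ChartedSpace (EuclideanSpace ℝ (Fin n)) M]
section
variable [IsManifold (𝓡 n) ∞ M]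

/-! ### Locality of the operators -/

theorem mvfderiv_congr_of_eventuallyEq {f g : M → ℝ} {y : M} (h : f =ᶠ[𝓝 y] g) :
    mvfderiv (𝓡 n) f y = mvfderiv (𝓡 n) g y :=
  h.mfderiv_eq

theorem covDerivForm_congr {cov : CovOp n M} {y : M} {s : Set M} (hs : s ∈ 𝓝 y)
    (hcov : IsCovariantDerivativeOn (I := 𝓡 n) (EuclideanSpace ℝ (Fin n)) cov s) {p : ℕ}
    (η : ∀ y : M, (TangentSpace (𝓡 n) y) [⋀^Fin p]→L[ℝ] ℝ)
    {X X' : ∀ y : M, TangentSpace (𝓡 n) y} {Y Y' : Fin p → ∀ y : M, TangentSpace (𝓡 n) y}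
    (hX : X y = X' y) (hY : ∀ k, Y k =ᶠ[𝓝 y] Y' k) (hd : ∀ k, FieldDiffAt (Y k) y)
    (hd' : ∀ k, FieldDiffAt (Y' k) y) :
    covDerivForm cov η X Y y = covDerivForm cov η X' Y' y := by
  have h1 : (fun z => η z (fun k => Y k z)) =ᶠ[𝓝 y] fun z => η z (fun k => Y' k z) := by
    filter_upwards [eventually_all.2 hY] with z hz
    simp_rw [hz]
  have h2 : ∀ k, cov (Y k) y = cov (Y' k) y := fun k =>
    hcov.congr_of_eventuallyEq (hd k) (hd' k) hs (hY k)
  have h3 : ∀ k, Y k y = Y' k y := fun k => (hY k).self_of_nhds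
  simp only [covDerivForm, mvfderiv_congr_of_eventuallyEq h1, h2, h3, hX]

/-- `cov` is applied only to the coordinate fields of the chart at `y`, never to a field depending
on α, so no locality property of `cov` is involved. -/
theorem covDerivOneForm_congr {cov : CovOp n M} {y : M}
    {X X' : ∀ y : M, TangentSpace (𝓡 n) y} {α α' : ∀ y : M, TangentSpace (𝓡 n) y →L[ℝ] ℝ}
    (hX : X y = X' y) (hα : ∀ᶠ z in 𝓝 y, α z = α' z) :
    covDerivOneForm cov α X y = covDerivOneForm cov α' X' y := by
  have h1 : ∀ Z : ∀ y : M, TangentSpace (𝓡 n) y,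
      (fun z => α z (Z z)) =ᶠ[𝓝 y] fun z => α' z (Z z) := fun Z => by
    filter_upwards [hα] with z hz
    rw [hz]
  simp only [covDerivOneForm, mvfderiv_congr_of_eventuallyEq (h1 _), hα.self_of_nhds, hX]

theorem covDerivMultivector_congr (cov : CovOp n M) {y : M} {q : ℕ}
    (V : ∀ y : M, ⋀[ℝ]^q (TangentSpace (𝓡 n) y))
    {X X' : ∀ y : M, TangentSpace (𝓡 n) y}
    {α α' : Fin q → ∀ y : M, TangentSpace (𝓡 n) y →L[ℝ] ℝ}
    (hX : X y = X' y) (hα : ∀ k, ∀ᶠ z in 𝓝 y, α k z = α' k z) :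
    covDerivMultivector cov V X α y = covDerivMultivector cov V X' α' y := by
  have h1 : (fun z => multivectorEval (V z) (fun k => α k z)) =ᶠ[𝓝 y]
      fun z => multivectorEval (V z) (fun k => α' k z) := by
    filter_upwards [eventually_all.2 hα] with z hz
    simp_rw [hz]
  have h2 : ∀ k, covDerivOneForm cov (α k) X y = covDerivOneForm cov (α' k) X' y := fun k =>
    covDerivOneForm_congr hX (hα k)
  have h3 : ∀ k, α k y = α' k y := fun k => (hα k).self_of_nhds
  simp only [covDerivMultivector, mvfderiv_congr_of_eventuallyEq h1, h2, h3, hX]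

/-- The covariant derivatives of a form only depend on the connection at the point. -/
theorem covDerivForm_congr_cov {cov cov' : CovOp n M} {y : M} {p : ℕ}
    (h : ∀ Z, FieldDiffAt Z y → cov Z y = cov' Z y)
    (η : ∀ y : M, (TangentSpace (𝓡 n) y) [⋀^Fin p]→L[ℝ] ℝ)
    (X : ∀ y : M, TangentSpace (𝓡 n) y) {Y : Fin p → ∀ y : M, TangentSpace (𝓡 n) y}
    (hd : ∀ k, FieldDiffAt (Y k) y) :
    covDerivForm cov η X Y y = covDerivForm cov' η X Y y := by
  simp only [covDerivForm, h _ (hd _)]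

theorem covDerivMultivector_congr_cov {cov cov' : CovOp n M} {y : M} {q : ℕ}
    (h : ∀ Z, FieldDiffAt Z y → cov Z y = cov' Z y)
    (V : ∀ y : M, ⋀[ℝ]^q (TangentSpace (𝓡 n) y))
    (X : ∀ y : M, TangentSpace (𝓡 n) y)
    (α : Fin q → ∀ y : M, TangentSpace (𝓡 n) y →L[ℝ] ℝ) :
    covDerivMultivector cov V X α y = covDerivMultivector cov' V X α y := by
  have he : ∀ i, cov (coordField (chartAt (EuclideanSpace ℝ (Fin n)) y) i) y =
      cov' (coordField (chartAt (EuclideanSpace ℝ (Fin n)) y) i) y := fun i =>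
    h _ (fieldSmoothAt_coordField (IsManifold.chart_mem_maximalAtlas y)
      (mem_chart_source _ y) i).fieldDiffAt
  have h1 : ∀ k, covDerivOneForm cov (α k) X y = covDerivOneForm cov' (α k) X y := fun k => by
    simp only [covDerivOneForm, he]
  simp only [covDerivMultivector, h1]

/-! ### Extension of local fields and forms, restriction to open subsets -/

variable [T2Space M]

/-- Hausdorffness enters here: a bump function in a chart is extended by zero, and its compact
support must be closed in `M` for the extension to be smooth. -/
theorem exists_bump {U : Set M} (hU : IsOpen U) {y : M} (hy : y ∈ U) :
    ∃ ψ : M → ℝ, ContMDiff (𝓡 n) 𝓘(ℝ, ℝ) ∞ ψ ∧ tsupport ψ ⊆ U ∧ ∀ᶠ z in 𝓝 y, ψ z = 1 := by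
  obtain ⟨ψ, -, hψ⟩ := (SmoothBumpFunction.nhds_basis_tsupport (I := 𝓡 n) y).mem_iff.1
    (hU.mem_nhds hy)
  exact ⟨ψ, ψ.contMDiff, hψ, ψ.eventuallyEq_one⟩

theorem SmoothVectorFieldOn.exists_extension {X : ∀ y : M, TangentSpace (𝓡 n) y} {U : Set M}
    (h : SmoothVectorFieldOn X U) (hU : IsOpen U) {y : M} (hy : y ∈ U) :
    ∃ X' : ∀ y : M, TangentSpace (𝓡 n) y, (∀ z, FieldSmoothAt X' z) ∧ X =ᶠ[𝓝 y] X' := by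
  obtain ⟨ψ, hψ, hsupp, hev⟩ := exists_bump (n := n) hU hy
  refine ⟨ψ • X, ContMDiffOn.smul_section_of_tsupport hψ.contMDiffOn hU hsupp h, ?_⟩
  filter_upwards [hev] with z hz
  rw [Pi.smul_apply', hz, one_smul]

theorem SmoothOneFormOn.exists_extension {α : ∀ y : M, TangentSpace (𝓡 n) y →L[ℝ] ℝ} {U : Set M}
    (h : SmoothOneFormOn α U) (hU : IsOpen U) {y : M} (hy : y ∈ U) :
    ∃ α' : ∀ y : M, TangentSpace (𝓡 n) y →L[ℝ] ℝ, (∀ W, SmoothOneFormOn α' W) ∧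
      ∀ᶠ z in 𝓝 y, α z = α' z := by
  obtain ⟨ψ, hψ, hsupp, hev⟩ := exists_bump (n := n) hU hy
  refine ⟨ψ • α, fun W e he i z hz => ContMDiffAt.contMDiffWithinAt ?_, ?_⟩
  · by_cases hzU : z ∈ U
    · exact ContMDiffAt.smul hψ.contMDiffAt
        ((h e he i).contMDiffAt ((e.open_source.inter hU).mem_nhds ⟨hz.1, hzU⟩))
    · refine contMDiffAt_const (c := (0 : ℝ)) |>.congr_of_eventuallyEq ?_
      filter_upwards [(isClosed_tsupport ψ).isOpen_compl.mem_nhds fun h => hzU (hsupp h)] with w hw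
      rw [Pi.smul_apply', image_eq_zero_of_notMem_tsupport hw, zero_smul]
      rfl
  · filter_upwards [hev] with z hz
    rw [Pi.smul_apply', hz, one_smul]

variable {cov : CovOp n M} {U W : Set M}

/-- A field smooth only on `W` is not a test field for `U`. Near each point it is replaced by a
global smooth field, and locality of the covariant derivative shows that the result is unchanged
near that point. -/
theorem IsLinearConnectionOn.mono (h : IsLinearConnectionOn cov U) (hU : IsOpen U)
    (hW : IsOpen W) (hWU : W ⊆ U) : IsLinearConnectionOn cov W where
  isCovariantDerivativeOn := h.isCovariantDerivativeOn.mono hWU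
  smooth := ⟨by
    intro Y hY y hy
    obtain ⟨Y', hY', hev⟩ := SmoothVectorFieldOn.exists_extension hY hW hy
    have h1 := (h.smooth.contMDiff (σ := Y') fun z _ => (hY' z).contMDiffWithinAt).contMDiffAt
      (hU.mem_nhds (hWU hy))
    refine (h1.congr_of_eventuallyEq ?_).contMDiffWithinAt
    filter_upwards [hev.eventually_nhds, hW.mem_nhds hy] with z hz hzW
    rw [h.isCovariantDerivativeOn.congr_of_eventuallyEq
      (SmoothVectorFieldOn.fieldSmoothAt hY hW hzW).fieldDiffAt (hY' z).fieldDiffAt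
      (hU.mem_nhds (hWU hzW)) hz]⟩

theorem IsSymmetricOn.mono (hs : IsSymmetricOn cov U) (h : IsLinearConnectionOn cov U)
    (hU : IsOpen U) (hW : IsOpen W) (hWU : W ⊆ U) : IsSymmetricOn cov W := by
  intro X Y hX hY y hy
  obtain ⟨X', hX', hXX'⟩ := hX.exists_extension hW hy
  obtain ⟨Y', hY', hYY'⟩ := hY.exists_extension hW hy
  have hc := h.isCovariantDerivativeOn
  have hn := hU.mem_nhds (hWU hy)
  rw [hc.congr_of_eventuallyEq (hX.fieldSmoothAt hW hy).fieldDiffAt (hX' y).fieldDiffAt hn hXX',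
    hc.congr_of_eventuallyEq (hY.fieldSmoothAt hW hy).fieldDiffAt (hY' y).fieldDiffAt hn hYY',
    hXX'.mlieBracket_vectorField_eq hYY', hXX'.self_of_nhds, hYY'.self_of_nhds]
  exact hs X' Y' (.of_forall fun z _ => hX' z) (.of_forall fun z _ => hY' z) y (hWU hy)

theorem IsFlatOn.mono (hf : IsFlatOn cov U) (h : IsLinearConnectionOn cov U)
    (hU : IsOpen U) (hW : IsOpen W) (hWU : W ⊆ U) : IsFlatOn cov W := by
  intro X Y Z hX hY hZ y hy
  obtain ⟨X', hX', hXX'⟩ := hX.exists_extension hW hy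
  obtain ⟨Y', hY', hYY'⟩ := hY.exists_extension hW hy
  obtain ⟨Z', hZ', hZZ'⟩ := hZ.exists_extension hW hy
  have hW' := h.mono hU hW hWU
  have hc := h.isCovariantDerivativeOn
  have hn := hU.mem_nhds (hWU hy)
  -- The curvature differentiates twice, so the inner covariant derivatives must agree on a
  -- neighbourhood of `y`, not merely at `y`.
  have hev : ∀ {T T' : ∀ y : M, TangentSpace (𝓡 n) y}, T =ᶠ[𝓝 y] T' →
      (fun z => cov Z z (T z)) =ᶠ[𝓝 y] fun z => cov Z' z (T' z) := fun hT => by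
    filter_upwards [hT, hZZ'.eventually_nhds, hW.mem_nhds hy] with z h1 h2 h3
    rw [h1, hc.congr_of_eventuallyEq (hZ.fieldSmoothAt hW h3).fieldDiffAt (hZ' z).fieldDiffAt
      (hU.mem_nhds (hWU h3)) h2]
  have hsm : ∀ T', (∀ z, FieldSmoothAt T' z) → FieldDiffAt (fun z => cov Z' z (T' z)) y :=
    fun T' hT' => ((h.smoothVectorFieldOn (SmoothVectorFieldOn.of_forall fun z _ => hT' z)
      (SmoothVectorFieldOn.of_forall fun z _ => hZ' z)).fieldSmoothAt hU (hWU hy)).fieldDiffAt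
  have e1 := hc.congr_of_eventuallyEq
    ((hW'.smoothVectorFieldOn hY hZ).fieldSmoothAt hW hy).fieldDiffAt (hsm Y' hY') hn (hev hYY')
  have e2 := hc.congr_of_eventuallyEq
    ((hW'.smoothVectorFieldOn hX hZ).fieldSmoothAt hW hy).fieldDiffAt (hsm X' hX') hn (hev hXX')
  rw [e1, e2,
    hc.congr_of_eventuallyEq (hZ.fieldSmoothAt hW hy).fieldDiffAt (hZ' y).fieldDiffAt hn hZZ',
    hXX'.mlieBracket_vectorField_eq hYY', hXX'.self_of_nhds, hYY'.self_of_nhds]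
  exact hf X' Y' Z' (.of_forall fun z _ => hX' z) (.of_forall fun z _ => hY' z)
    (.of_forall fun z _ => hZ' z) y (hWU hy)

theorem DiffForm.ParallelOn.mono {p : ℕ} {η : DiffForm n M p} (hη : η.ParallelOn cov U)
    (h : IsLinearConnectionOn cov U) (hU : IsOpen U) (hW : IsOpen W) (hWU : W ⊆ U) :
    η.ParallelOn cov W := by
  intro X Y hX hY y hy
  obtain ⟨X', hX', hXX'⟩ := hX.exists_extension hW hy
  choose Y' hY' hYY' using fun k => (hY k).exists_extension hW hy
  rw [covDerivForm_congr (hU.mem_nhds (hWU hy)) h.isCovariantDerivativeOn η.toFun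
    hXX'.self_of_nhds hYY' (fun k => ((hY k).fieldSmoothAt hW hy).fieldDiffAt)
    (fun k => (hY' k y).fieldDiffAt)]
  exact hη X' Y' (.of_forall fun z _ => hX' z) (fun k => .of_forall fun z _ => hY' k z) y (hWU hy)

theorem MultivectorField.ParallelOn.mono {q : ℕ} {V : MultivectorField n M q}
    (hV : V.ParallelOn cov U) (hW : IsOpen W) (hWU : W ⊆ U) : V.ParallelOn cov W := by
  intro X α hX hα y hy
  obtain ⟨X', hX', hXX'⟩ := hX.exists_extension hW hy
  choose α' hα' hαα' using fun k => (hα k).exists_extension hW hy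
  rw [covDerivMultivector_congr cov V.toFun hXX'.self_of_nhds hαα']
  exact hV X' α' (.of_forall fun z _ => hX' z) (fun k => hα' k U) y (hWU hy)

end
end ConstCoeff

/-! ### Straightening a symmetric flat connection -/

namespace ConstCoeff
open Filter Topology Set

/-- The inverse function theorem, with a smooth inverse defined on a ball. -/
theorem exists_openPartialHomeomorph_of_fderiv_eq_id {E : Type*} [NormedAddCommGroup E]
    [NormedSpace ℝ E] [CompleteSpace E] {φ : E → E} {O : Set E} (hO : IsOpen O)
    (hφ : ContDiffOn ℝ ∞ φ O) {z₀ : E} (hz₀ : z₀ ∈ O)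
    (hd : fderiv ℝ φ z₀ = ContinuousLinearMap.id ℝ E) :
    ∃ ψ : OpenPartialHomeomorph E E, ⇑ψ = φ ∧ z₀ ∈ ψ.source ∧ ψ.source ⊆ O ∧
      (∀ z ∈ ψ.target, ContDiffAt ℝ ∞ ψ.symm z) ∧
      IsPreconnected ψ.target := by
  have hat : ∀ z ∈ O, ContDiffAt ℝ ∞ φ z := fun z hz => hφ.contDiffAt (hO.mem_nhds hz)
  have hdiff : ∀ z ∈ O, HasFDerivAt φ (fderiv ℝ φ z) z := fun z hz =>
    ((hat z hz).differentiableAt (by simp)).hasFDerivAt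
  -- The open set of points where Dφ is invertible. Restricting the local inverse to it makes the
  -- inverse smooth on its whole domain rather than only at the image of `z₀`.
  set O' : Set E := O ∩ fderiv ℝ φ ⁻¹' range ((↑) : (E ≃L[ℝ] E) → E →L[ℝ] E) with hO'
  have hO'open : IsOpen O' :=
    (hφ.continuousOn_fderiv_of_isOpen hO (by simp)).isOpen_inter_preimage hO
      ContinuousLinearEquiv.isOpen
  have hz₀' : z₀ ∈ O' := ⟨hz₀, ContinuousLinearEquiv.refl ℝ E, by rw [hd]; rfl⟩
  have hd' : HasFDerivAt φ ((ContinuousLinearEquiv.refl ℝ E : E ≃L[ℝ] E) : E →L[ℝ] E) z₀ := by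
    have := hdiff z₀ hz₀
    rw [hd] at this
    exact this
  set ψ₀ := (hat z₀ hz₀).toOpenPartialHomeomorph φ hd' (by simp)
  have hψ₀ : ⇑ψ₀ = φ := rfl
  have hz₀s : z₀ ∈ ψ₀.source := ContDiffAt.mem_toOpenPartialHomeomorph_source _ hd' (by simp)
  set ψ₁ := ψ₀.restrOpen O' hO'open
  have hψ₁ : ⇑ψ₁ = φ := rfl
  have hz₁ : z₀ ∈ ψ₁.source := ⟨hz₀s, hz₀'⟩
  obtain ⟨ε, hε, hball⟩ := Metric.isOpen_iff.1 ψ₁.open_target _ (ψ₁.map_source hz₁)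
  -- Shrinking the target to a ball makes it convex, hence the resulting coordinate domain
  -- connected, as the criterion for ∇^u demands.
  set ψ := ψ₁.trans (OpenPartialHomeomorph.ofSet (Metric.ball (ψ₁ z₀) ε) Metric.isOpen_ball)
  have hψ : ⇑ψ = φ := rfl
  have hsource : ψ.source ⊆ O' := fun z hz => hz.1.2
  have htarget : ψ.target = Metric.ball (ψ₁ z₀) ε :=
    Subset.antisymm (fun z hz => hz.1) fun z hz => ⟨hz, hball hz⟩
  refine ⟨ψ, hψ, ⟨hz₁, Metric.mem_ball_self hε⟩, fun z hz => (hsource hz).1, fun z hz => ?_,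
    htarget ▸ (convex_ball _ _).isPreconnected⟩
  have hs := hsource (ψ.map_target hz)
  obtain ⟨L, hL⟩ := hs.2
  refine ψ.contDiffAt_symm (f₀' := L) hz ?_ (hψ ▸ hat _ hs.1)
  rw [hL, hψ]
  exact hdiff _ hs.1

variable {n : ℕ} {M : Type*} [TopologicalSpace M] [ChartedSpace (EuclideanSpace ℝ (Fin n)) M]
variable {e : OpenPartialHomeomorph M (EuclideanSpace ℝ (Fin n))}

/-- The vector field with constant components `v` in the coordinate system `e`. -/
def constField (e : OpenPartialHomeomorph M (EuclideanSpace ℝ (Fin n)))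
    (v : EuclideanSpace ℝ (Fin n)) (y : M) : TangentSpace (𝓡 n) y :=
  coordLift e y v

/-- The Christoffel symbols of a connection in the coordinate system `e`:
`christoffel cov e z v w` is the representation of `∇_v w` for constant fields `v` and `w`. -/
def christoffel (cov : CovOp n M) (e : OpenPartialHomeomorph M (EuclideanSpace ℝ (Fin n)))
    (z : EuclideanSpace ℝ (Fin n)) :
    EuclideanSpace ℝ (Fin n) →L[ℝ] EuclideanSpace ℝ (Fin n) →L[ℝ] EuclideanSpace ℝ (Fin n) :=
  ∑ i, ∑ j, (EuclideanSpace.proj i : EuclideanSpace ℝ (Fin n) →L[ℝ] ℝ).smulRight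
    ((EuclideanSpace.proj j : EuclideanSpace ℝ (Fin n) →L[ℝ] ℝ).smulRight
      (fieldRep e (fun y => cov (coordField e j) y (coordField e i y)) z))

theorem christoffel_apply (cov : CovOp n M) (z v w : EuclideanSpace ℝ (Fin n)) :
    christoffel cov e z v w = ∑ i, ∑ j, v i • w j •
      fieldRep e (fun y => cov (coordField e j) y (coordField e i y)) z := by
  simp [christoffel, _root_.sum_apply]

section
variable [IsManifold (𝓡 n) ∞ M]

theorem fieldRep_constField (he : e ∈ coordinateSystems n M) (v : EuclideanSpace ℝ (Fin n))
    {z : EuclideanSpace ℝ (Fin n)} (hz : z ∈ e.target) : fieldRep e (constField e v) z = v :=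
  coordDiff_coordLift he (e.map_target hz) v

theorem fieldRep_constField_eventuallyEq (he : e ∈ coordinateSystems n M)
    (v : EuclideanSpace ℝ (Fin n)) {y : M} (hy : y ∈ e.source) :
    fieldRep e (constField e v) =ᶠ[𝓝 (e y)] fun _ => v := by
  filter_upwards [e.open_target.mem_nhds (e.map_source hy)] with z hz
    using fieldRep_constField he v hz

theorem fieldSmoothAt_constField (he : e ∈ coordinateSystems n M) (v : EuclideanSpace ℝ (Fin n))
    {y : M} (hy : y ∈ e.source) : FieldSmoothAt (constField e v) y :=
  (contMDiffAt_field_iff he hy).2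
    (contDiffAt_const.congr_of_eventuallyEq (fieldRep_constField_eventuallyEq he v hy))

variable {cov : CovOp n M} {U : Set M}

/-- The local expression of a covariant derivative. -/
theorem coordDiff_cov (he : e ∈ coordinateSystems n M) {y : M} (hy : y ∈ e.source)
    (hU : U ∈ 𝓝 y)
    (hcov : IsCovariantDerivativeOn (I := 𝓡 n) (EuclideanSpace ℝ (Fin n)) cov U)
    {Y : ∀ y : M, TangentSpace (𝓡 n) y} (hY : FieldDiffAt Y y) (v : TangentSpace (𝓡 n) y) :
    coordDiff e y (cov Y y v) = fderiv ℝ (fieldRep e Y) (e y) (coordDiff e y v) +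
      christoffel cov e (e y) (coordDiff e y v) (fieldRep e Y (e y)) := by
  have h1 : ∀ j, coordDiff e y (cov (coordField e j) y v) = ∑ i, coordDiff e y v i •
      fieldRep e (fun y => cov (coordField e j) y (coordField e i y)) (e y) := fun j => by
    conv_lhs => rw [← sum_coordForm_smul_coordField he hy v]
    rw [map_sum, map_sum]
    refine Finset.sum_congr rfl fun i _ => ?_
    rw [map_smul, map_smul, fieldRep_apply hy, coordForm_apply he hy]
  rw [IsCovariantDerivativeOn.eq_sum_coordField he hy hU hcov hY, _root_.sum_apply, map_sum]
  simp only [_root_.add_apply, _root_.smul_apply, ContinuousLinearMap.smulRight_apply, map_add,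
    map_smul]
  rw [Finset.sum_add_distrib, add_comm]
  congr 1
  · simp_rw [mvfderiv_coordForm_apply he hy hY]
    simp_rw [← map_smul]
    rw [← map_sum, sum_smul_coordField, coordDiff_coordLift he hy]
  · rw [christoffel_apply, Finset.sum_comm]
    refine Finset.sum_congr rfl fun j _ => ?_
    rw [h1, Finset.smul_sum, coordForm_apply he hy, fieldRep_apply hy]
    exact Finset.sum_congr rfl fun i _ => smul_comm _ _ _

theorem coordDiff_cov_constField (he : e ∈ coordinateSystems n M) {y : M} (hy : y ∈ e.source)
    (hU : U ∈ 𝓝 y)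
    (hcov : IsCovariantDerivativeOn (I := 𝓡 n) (EuclideanSpace ℝ (Fin n)) cov U)
    (v w : EuclideanSpace ℝ (Fin n)) :
    coordDiff e y (cov (constField e w) y (constField e v y)) = christoffel cov e (e y) v w := by
  rw [coordDiff_cov he hy hU hcov (fieldSmoothAt_constField he w hy).fieldDiffAt,
    (fieldRep_constField_eventuallyEq he w hy).fderiv_eq, fieldRep_constField he w (e.map_source hy),
    constField, coordDiff_coordLift he hy]
  simp

theorem contDiffAt_christoffel (he : e ∈ coordinateSystems n M) (hU : IsOpen U)
    (hUe : U ⊆ e.source) (hcov : IsLinearConnectionOn cov U) {y : M} (hy : y ∈ U) :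
    ContDiffAt ℝ ∞ (christoffel cov e) (e y) := by
  have h1 : ∀ i j, ContDiffAt ℝ ∞
      (fieldRep e (fun y => cov (coordField e j) y (coordField e i y))) (e y) := fun i j => by
    have hf : ∀ i, SmoothVectorFieldOn (coordField e i) U := fun i =>
      SmoothVectorFieldOn.of_forall fun z hz => fieldSmoothAt_coordField he (hUe hz) i
    exact (contMDiffAt_field_iff he (hUe hy)).1
      ((hcov.smoothVectorFieldOn (hf i) (hf j)).fieldSmoothAt hU hy)
  unfold christoffel
  exact ContDiffAt.sum fun i _ => ContDiffAt.sum fun j _ =>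
    contDiffAt_const.smulRight (contDiffAt_const.smulRight (h1 i j))

theorem mlieBracket_constField (he : e ∈ coordinateSystems n M) {y : M} (hy : y ∈ e.source)
    (v w : EuclideanSpace ℝ (Fin n)) :
    VectorField.mlieBracket (𝓡 n) (constField e v) (constField e w) y = 0 := by
  apply coordDiff_injective he hy
  rw [coordDiff_mlieBracket he hy (fieldSmoothAt_constField he v hy).fieldDiffAt
    (fieldSmoothAt_constField he w hy).fieldDiffAt,
    (fieldRep_constField_eventuallyEq he w hy).fderiv_eq,
    (fieldRep_constField_eventuallyEq he v hy).fderiv_eq]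
  simp

/-- Constant fields have zero bracket, so vanishing torsion on them is symmetry of Γ. -/
theorem IsSymmetricOn.christoffel_comm (he : e ∈ coordinateSystems n M) (hU : IsOpen U)
    (hUe : U ⊆ e.source) (hcov : IsLinearConnectionOn cov U) (hs : IsSymmetricOn cov U) {y : M}
    (hy : y ∈ U) (v w : EuclideanSpace ℝ (Fin n)) :
    christoffel cov e (e y) v w = christoffel cov e (e y) w v := by
  have hf : ∀ v, SmoothVectorFieldOn (constField e v) U := fun v =>
    SmoothVectorFieldOn.of_forall fun z hz => fieldSmoothAt_constField he v (hUe hz)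
  have h := hs (constField e v) (constField e w) (hf v) (hf w) y hy
  rw [mlieBracket_constField he (hUe hy), sub_zero, sub_eq_zero] at h
  have hc := coordDiff_cov_constField he (hUe hy) (hU.mem_nhds hy) hcov.isCovariantDerivativeOn
  rw [← hc, ← hc, h]

/-- For constant fields the bracket term drops out, and ∇_v ∇_w l has components DΓ(v)(w, l) + Γ(v,
Γ(w, l)); flatness says this is symmetric in v and w. -/
theorem IsFlatOn.christoffel_flat (he : e ∈ coordinateSystems n M) (hU : IsOpen U)
    (hUe : U ⊆ e.source) (hcov : IsLinearConnectionOn cov U) (hf : IsFlatOn cov U) {y : M}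
    (hy : y ∈ U) (v w l : EuclideanSpace ℝ (Fin n)) :
    fderiv ℝ (christoffel cov e) (e y) v w l +
        christoffel cov e (e y) v (christoffel cov e (e y) w l) =
      fderiv ℝ (christoffel cov e) (e y) w v l +
        christoffel cov e (e y) w (christoffel cov e (e y) v l) := by
  have hfield : ∀ v, SmoothVectorFieldOn (constField e v) U := fun v =>
    SmoothVectorFieldOn.of_forall fun z hz => fieldSmoothAt_constField he v (hUe hz)
  have hye := hUe hy
  have hc := hcov.isCovariantDerivativeOn
  have hΓ : DifferentiableAt ℝ (christoffel cov e) (e y) :=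
    (contDiffAt_christoffel he hU hUe hcov hy).differentiableAt (by simp)
  have hrep : ∀ v, fieldRep e (fun z => cov (constField e l) z (constField e v z)) =ᶠ[𝓝 (e y)]
      fun z => christoffel cov e z v l := fun v => by
    filter_upwards [e.open_target.mem_nhds (e.map_source hye),
      (e.tendsto_symm hye).eventually (hU.mem_nhds hy)] with z hz hzU
    rw [fieldRep, coordDiff_cov_constField he (e.map_target hz) (hU.mem_nhds hzU) hc,
      e.right_inv hz]
  have hsecond : ∀ v w, coordDiff e y
      (cov (fun z => cov (constField e l) z (constField e w z)) y (constField e v y)) =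
      fderiv ℝ (christoffel cov e) (e y) v w l +
        christoffel cov e (e y) v (christoffel cov e (e y) w l) := fun v w => by
    rw [coordDiff_cov he hye (hU.mem_nhds hy) hc
      ((hcov.smoothVectorFieldOn (hfield w) (hfield l)).fieldSmoothAt hU hy).fieldDiffAt,
      (hrep w).fderiv_eq, (hrep w).self_of_nhds, constField, coordDiff_coordLift he hye]
    congr 1
    have h1 := ((hΓ.hasFDerivAt.clm_apply (hasFDerivAt_const w (e y))).clm_apply
      (hasFDerivAt_const l (e y))).fderiv
    rw [h1]
    simp
  have h := hf (constField e v) (constField e w) (constField e l) (hfield v) (hfield w)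
    (hfield l) y hy
  rw [mlieBracket_constField he hye, map_zero, sub_zero, sub_eq_zero] at h
  rw [← hsecond, ← hsecond, h]

/-- Composing a coordinate system with a local diffeomorphism. -/
theorem exists_coordinateSystem_comp (he : e ∈ coordinateSystems n M) {x : M} (hx : x ∈ e.source)
    {φ : EuclideanSpace ℝ (Fin n) → EuclideanSpace ℝ (Fin n)} {O : Set (EuclideanSpace ℝ (Fin n))}
    (hO : IsOpen O) (hOe : O ⊆ e.target) (hφ : ContDiffOn ℝ ∞ φ O) (hxO : e x ∈ O)
    (hd : fderiv ℝ φ (e x) = ContinuousLinearMap.id ℝ (EuclideanSpace ℝ (Fin n))) :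
    ∃ u ∈ coordinateSystems n M, x ∈ u.source ∧ IsPreconnected u.source ∧
      ∀ y ∈ u.source, y ∈ e.source ∧ e y ∈ O ∧ u y = φ (e y) := by
  obtain ⟨ψ, hψφ, hxψ, hψO, hsymm, hconn⟩ :=
    exists_openPartialHomeomorph_of_fderiv_eq_id hO hφ hxO hd
  have hu : e.trans ψ ∈ coordinateSystems n M := by
    refine OpenPartialHomeomorph.mem_maximalAtlas_of_contMDiffOn _ (fun y hy => ?_) fun z hz => ?_
    · have h : ContMDiffAt (𝓡 n) (𝓡 n) ∞ ψ (e y) := by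
        rw [hψφ]
        exact (hφ.contDiffAt (hO.mem_nhds (hψO hy.2))).contMDiffAt
      exact (h.comp y (contMDiffAt_coord he hy.1)).contMDiffWithinAt
    · have h : ContMDiffAt (𝓡 n) (𝓡 n) ∞ e.symm (ψ.symm z) := contMDiffAt_coord_symm he hz.2
      exact (h.comp z (hsymm z hz.1).contMDiffAt).contMDiffWithinAt
  have htarget : (e.trans ψ).target = ψ.target :=
    Subset.antisymm (fun z hz => hz.1) fun z hz => ⟨hz, hOe (hψO (ψ.map_target hz))⟩
  refine ⟨e.trans ψ, hu, ⟨hx, hxψ⟩, ?_, fun y hy => ⟨hy.1, hψO hy.2, congrFun hψφ (e y)⟩⟩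
  rw [← (e.trans ψ).symm_image_target_eq_source]
  exact (htarget ▸ hconn).image _ (e.trans ψ).continuousOn_symm

/-- In coordinates straightening the connection, the coordinate frame is parallel. -/
theorem cov_coordField_eq_zero {u : OpenPartialHomeomorph M (EuclideanSpace ℝ (Fin n))}
    (hu : u ∈ coordinateSystems n M) (he : e ∈ coordinateSystems n M)
    {φ : EuclideanSpace ℝ (Fin n) → EuclideanSpace ℝ (Fin n)} {O : Set (EuclideanSpace ℝ (Fin n))}
    (hO : IsOpen O) (hφ : ContDiffOn ℝ ∞ φ O)
    (hue : ∀ y ∈ u.source, y ∈ e.source ∧ e y ∈ O ∧ u y = φ (e y)) {y : M} (hy : y ∈ u.source)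
    (hU : U ∈ 𝓝 y)
    (hcov : IsCovariantDerivativeOn (I := 𝓡 n) (EuclideanSpace ℝ (Fin n)) cov U)
    (hΓ : ∀ v w, fderiv ℝ (fderiv ℝ φ) (e y) v w = fderiv ℝ φ (e y) (christoffel cov e (e y) v w))
    (j : Fin n) : cov (coordField u j) y = 0 := by
  have hchain : ∀ z ∈ u.source, ∀ v, coordDiff u z v = fderiv ℝ φ (e z) (coordDiff e z v) := by
    intro z hz v
    refine (mvfderiv_apply_eq_fderiv he (hue z hz).1 (mdifferentiableAt_coord hu hz) v).trans ?_
    have hev : u ∘ e.symm =ᶠ[𝓝 (e z)] φ := by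
      filter_upwards [e.open_target.mem_nhds (e.map_source (hue z hz).1),
        (e.tendsto_symm (hue z hz).1).eventually (u.open_source.mem_nhds hz)] with w hw hwu
      rw [Function.comp_apply, (hue _ hwu).2.2, e.right_inv hw]
    rw [hev.fderiv_eq]
  obtain ⟨hye, hyO, -⟩ := hue y hy
  have hd := (fieldSmoothAt_coordField hu hy j).fieldDiffAt
  have hφ' : DifferentiableAt ℝ (fderiv ℝ φ) (e y) :=
    ((hφ.contDiffAt (hO.mem_nhds hyO)).fderiv_right (m := 1)
      (by rw [one_add_one_eq_two]; exact two_le_infty)).differentiableAt one_ne_zero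
  -- Let Y be the `e`-components of ∂/∂uʲ. By the chain rule Dφ(Y) is a constant vector;
  -- differentiating gives D²φ(v, Y) + Dφ(DY(v)) = 0. By `hΓ` this is Dφ(Γ(v, Y) + DY(v)) = 0, the
  -- `u`-components of ∇_v ∂/∂uʲ.
  have hev : (fun z => fderiv ℝ φ z (fieldRep e (coordField u j) z)) =ᶠ[𝓝 (e y)]
      fun _ => EuclideanSpace.single j 1 := by
    filter_upwards [e.open_target.mem_nhds (e.map_source hye),
      (e.tendsto_symm hye).eventually (u.open_source.mem_nhds hy)] with z hz hzu
    have h := hchain _ hzu (coordField u j (e.symm z))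
    rw [coordDiff_coordField hu hzu, e.right_inv hz] at h
    exact h.symm
  have hder := hev.fderiv_eq (𝕜 := ℝ)
  rw [(hφ'.hasFDerivAt.clm_apply
    ((mdifferentiableAt_field_iff he hye).1 hd).hasFDerivAt).fderiv] at hder
  ext1 v
  apply coordDiff_injective hu hy
  have h := congrArg (fun L : EuclideanSpace ℝ (Fin n) →L[ℝ] EuclideanSpace ℝ (Fin n) =>
    L (coordDiff e y v)) hder
  simp only [_root_.add_apply, ContinuousLinearMap.comp_apply, ContinuousLinearMap.flip_apply,
    fderiv_fun_const, Pi.zero_apply, _root_.zero_apply] at h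
  rw [hchain y hy, coordDiff_cov he hye hU hcov hd, map_add, ← hΓ, _root_.zero_apply, map_zero, h]

variable [T2Space M]

/-- A symmetric flat connection is locally the connection of a coordinate system. -/
theorem exists_coordinateSystem_of_flat (hU : IsOpen U) {x : M} (hx : x ∈ U)
    (hcov : IsLinearConnectionOn cov U) (hs : IsSymmetricOn cov U) (hf : IsFlatOn cov U) :
    ∃ u ∈ coordinateSystems n M, x ∈ u.source ∧ u x = 0 ∧ u.source ⊆ U ∧
      IsPreconnected u.source ∧
      ∀ y ∈ u.source, ∀ Z, FieldDiffAt Z y → cov Z y = coordConnection u Z y := by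
  set e := chartAt (EuclideanSpace ℝ (Fin n)) x
  have he : e ∈ coordinateSystems n M := IsManifold.chart_mem_maximalAtlas x
  have hxe : x ∈ e.source := mem_chart_source _ x
  have hU' : IsOpen (U ∩ e.source) := hU.inter e.open_source
  have hsub : U ∩ e.source ⊆ U := inter_subset_left
  have hsub' : U ∩ e.source ⊆ e.source := inter_subset_right
  have hs' := hs.mono hcov hU hU' hsub
  have hf' := hf.mono hcov hU hU' hsub
  have hcov' := hcov.mono hU hU' hsub
  set W := e.target ∩ e.symm ⁻¹' (U ∩ e.source)
  have hW : IsOpen W := e.isOpen_inter_preimage_symm hU'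
  have hΓ : ContDiffOn ℝ ∞ (christoffel cov e) W := fun z hz => by
    have h := contDiffAt_christoffel he hU' hsub' hcov' hz.2
    rw [e.right_inv hz.1] at h
    exact h.contDiffWithinAt
  obtain ⟨φ, r, hr, hrW, hφ, hφ0, hdφ, hΓφ⟩ := exists_flat_coordinates hW hΓ
    (fun z hz v w => by
      have h := hs'.christoffel_comm he hU' hsub' hcov' hz.2 v w
      rwa [e.right_inv hz.1] at h)
    (fun z hz v w l => by
      have h := hf'.christoffel_flat he hU' hsub' hcov' hz.2 v w l
      rwa [e.right_inv hz.1] at h)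
    (z₀ := e x) ⟨e.map_source hxe, by
      rw [mem_preimage, e.left_inv hxe]
      exact ⟨hx, hxe⟩⟩
  obtain ⟨u, hu, hxu, hconn, hue⟩ := exists_coordinateSystem_comp he hxe Metric.isOpen_ball
    (fun z hz => (hrW hz).1) hφ (Metric.mem_ball_self hr) hdφ
  have huU : u.source ⊆ U := fun y hy => by
    have h := (hrW (hue y hy).2.1).2
    rw [mem_preimage, e.left_inv (hue y hy).1] at h
    exact h.1
  refine ⟨u, hu, hxu, by rw [(hue x hxu).2.2, hφ0], huU, hconn, fun y hy Z hZ => ?_⟩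
  -- Both connections annihilate the frame ∂/∂uʲ, so they agree on every field differentiable at the
  -- point.
  refine IsCovariantDerivativeOn.eq_of_coordField hu hy (hU.mem_nhds (huU hy))
    (u.open_source.mem_nhds hy) hcov.isCovariantDerivativeOn
    (isCovariantDerivativeOn_coordConnection hu) (fun j => ?_) hZ
  rw [coordConnection_coordField hu hy, cov_coordField_eq_zero hu he Metric.isOpen_ball hφ hue hy
    (hU.mem_nhds (huU hy)) hcov.isCovariantDerivativeOn (hΓφ _ (hue y hy).2.1)]

/-- On a connected domain of coordinates centred at `x` the connection agrees with ∇^u on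
differentiable fields, which is all that ∇η uses for smooth test fields; the criterion for ∇^u then
applies. -/
theorem DiffForm.ParallelOn.constCoeffsNear {p : ℕ} {η : DiffForm n M p}
    (hη : η.ParallelOn cov U) (hU : IsOpen U) {x : M} (hx : x ∈ U)
    (hcov : IsLinearConnectionOn cov U) (hs : IsSymmetricOn cov U) (hf : IsFlatOn cov U) :
    η.ConstCoeffsNear x := by
  obtain ⟨u, hu, hxu, hx0, huU, hconn, heq⟩ := exists_coordinateSystem_of_flat hU hx hcov hs hf
  refine ⟨u, hu, hxu, hx0, DiffForm.ParallelOn.constCoeffsIn hu hconn fun X Y hX hY y hy => ?_⟩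
  rw [← covDerivForm_congr_cov (heq y hy) η.toFun X
    fun k => ((hY k).fieldSmoothAt u.open_source hy).fieldDiffAt]
  exact hη.mono hcov hU u.open_source huU X Y hX hY y hy

theorem MultivectorField.ParallelOn.constCoeffsNear {q : ℕ} {V : MultivectorField n M q}
    (hV : V.ParallelOn cov U) (hU : IsOpen U) {x : M} (hx : x ∈ U)
    (hcov : IsLinearConnectionOn cov U) (hs : IsSymmetricOn cov U) (hf : IsFlatOn cov U) :
    V.ConstCoeffsNear x := by
  obtain ⟨u, hu, hxu, hx0, huU, hconn, heq⟩ := exists_coordinateSystem_of_flat hU hx hcov hs hf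
  refine ⟨u, hu, hxu, hx0,
    MultivectorField.ParallelOn.constCoeffsIn hu hconn fun X α hX hα y hy => ?_⟩
  rw [← covDerivMultivector_congr_cov (heq y hy) V.toFun X α]
  exact hV.mono u.open_source huU X α hX hα y hy

end
end ConstCoeff

end

/-! ### The main theorem -/

theorem proposition2p1 {n : ℕ} {M : Type*} [TopologicalSpace M] [T2Space M]
    [ChartedSpace (EuclideanSpace ℝ (Fin n)) M] [IsManifold (𝓡 n) ∞ M]
    {p q : ℕ} (η : ConstCoeff.DiffForm n M p) (V : ConstCoeff.MultivectorField n M q) :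
    -- `∇^u` is the only linear connection on the domain of `u` parallelizing the frame
    -- `∂/∂u¹, …, ∂/∂uⁿ`, and it is symmetric and flat
    (∀ u ∈ ConstCoeff.coordinateSystems n M,
      ConstCoeff.IsLinearConnectionOn (ConstCoeff.coordConnection u) u.source ∧
      (∀ i j, ∀ y ∈ u.source,
        ConstCoeff.coordConnection u (ConstCoeff.coordField u j) y
          (ConstCoeff.coordField u i y) = 0) ∧
      (∀ cov : ConstCoeff.CovOp n M, ConstCoeff.IsLinearConnectionOn cov u.source →
        (∀ i j, ∀ y ∈ u.source,
          cov (ConstCoeff.coordField u j) y (ConstCoeff.coordField u i y) = 0) →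
        ∀ Y : (∀ y : M, TangentSpace (𝓡 n) y), ConstCoeff.SmoothVectorFieldOn Y u.source →
          ∀ y ∈ u.source, cov Y y = ConstCoeff.coordConnection u Y y) ∧
      ConstCoeff.IsSymmetricOn (ConstCoeff.coordConnection u) u.source ∧
      ConstCoeff.IsFlatOn (ConstCoeff.coordConnection u) u.source) ∧
    -- constant coefficients on `u` iff parallel for `∇^u`
    (∀ u ∈ ConstCoeff.coordinateSystems n M, IsPreconnected u.source →
      (η.ConstCoeffsIn u ↔ η.ParallelOn (ConstCoeff.coordConnection u) u.source) ∧
      (V.ConstCoeffsIn u ↔ V.ParallelOn (ConstCoeff.coordConnection u) u.source)) ∧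
    -- constant coefficients near `x` iff parallel near `x` for some symmetric flat connection
    (∀ x : M,
      (η.ConstCoeffsNear x ↔
        ∃ U : Set M, IsOpen U ∧ x ∈ U ∧ ∃ cov : ConstCoeff.CovOp n M,
          ConstCoeff.IsLinearConnectionOn cov U ∧ ConstCoeff.IsSymmetricOn cov U ∧
          ConstCoeff.IsFlatOn cov U ∧ η.ParallelOn cov U) ∧
      (V.ConstCoeffsNear x ↔
        ∃ U : Set M, IsOpen U ∧ x ∈ U ∧ ∃ cov : ConstCoeff.CovOp n M,
          ConstCoeff.IsLinearConnectionOn cov U ∧ ConstCoeff.IsSymmetricOn cov U ∧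
          ConstCoeff.IsFlatOn cov U ∧ V.ParallelOn cov U)) := by
  refine ⟨fun u hu => ⟨ConstCoeff.isLinearConnectionOn_coordConnection hu, fun i j y hy => ?_,
    fun cov hcov hframe Y hY y hy => ?_, ConstCoeff.isSymmetricOn_coordConnection hu,
    ConstCoeff.isFlatOn_coordConnection hu⟩, fun u hu hconn => ⟨⟨fun h => h.parallelOn hu,
      fun h => h.constCoeffsIn hu hconn⟩, ⟨fun h => h.parallelOn hu,
      fun h => h.constCoeffsIn hu hconn⟩⟩, fun x => ⟨⟨?_, ?_⟩, ⟨?_, ?_⟩⟩⟩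
  · rw [ConstCoeff.coordConnection_coordField hu hy]
    rfl
  · refine ConstCoeff.IsCovariantDerivativeOn.eq_of_coordField hu hy (u.open_source.mem_nhds hy)
      (u.open_source.mem_nhds hy) hcov.isCovariantDerivativeOn
      (ConstCoeff.isCovariantDerivativeOn_coordConnection hu) (fun j => ?_)
      (hY.fieldSmoothAt u.open_source hy).fieldDiffAt
    rw [ConstCoeff.coordConnection_coordField hu hy]
    -- The hypothesis gives zero only on the frame vectors ∂/∂uⁱ; linearity in the direction extends
    -- it to all tangent vectors.
    exact ConstCoeff.ext_coordField hu hy fun i => hframe i j y hy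
  · rintro ⟨u, hu, hxu, -, h⟩
    exact ⟨u.source, u.open_source, hxu, ConstCoeff.coordConnection u,
      ConstCoeff.isLinearConnectionOn_coordConnection hu,
      ConstCoeff.isSymmetricOn_coordConnection hu, ConstCoeff.isFlatOn_coordConnection hu,
      h.parallelOn hu⟩
  · rintro ⟨U, hU, hx, cov, hcov, hs, hf, h⟩
    exact h.constCoeffsNear hU hx hcov hs hf
  · rintro ⟨u, hu, hxu, -, h⟩
    exact ⟨u.source, u.open_source, hxu, ConstCoeff.coordConnection u,
      ConstCoeff.isLinearConnectionOn_coordConnection hu,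
      ConstCoeff.isSymmetricOn_coordConnection hu, ConstCoeff.isFlatOn_coordConnection hu,
      h.parallelOn hu⟩
  · rintro ⟨U, hU, hx, cov, hcov, hs, hf, h⟩
    exact h.constCoeffsNear hU hx hcov hs hf
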